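/- **Model.** A publisher has advertisers $\mathcal A=\{1,\dots,A\}$ and $N\ge 1$ arriving impressions. Put $\mathcal A_0=\mathcal A\cup\{0\}$, where $0$ stands for discarding. The quality vectors $Q_1,\dots,Q_N$ are i.i.d. copies of an $\mathbb R^A$-valued random vector $Q$ with integrable, almost surely non-negative coordinates (possibly dependent across advertisers); $Q_{n,0}=0$. Advertiser $a$ must receive exactly $C_a$ impressions; $\rho_a=C_a/N>0$ for $a\in\mathcal A$, and $\rho_0=1-\sum_{a\in\mathcal A}\rho_a>0$. An ad exchange (AdX) is described by $r(s)$, the expected revenue from offering an impression at the reserve price at which it is accepted with probability $s$ (for posted prices and a bid with survival function $\bar F$, $r(s)=s\bar F^{-1}(s)$). The function $r:[0,1]\to\mathbb R$ is regular: continuous, concave, non-negative, bounded, with $r(0)=\lim_{s\to0}r(s)=0$. Let $R(c)=\max_{s\in[0,1]}\{r(s)+(1-s)c\}$ and let $s^*(c)$ be its least maximizer. **Optimal online yield.** An admissible policy chooses for impression $n$, from the history and $Q_n$, an acceptance probability $s_n\in[0,1]$ and (possibly with randomization) an option $a_n\in\mathcal A_0$ to which the impression goes if AdX rejects it; acceptance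 has conditional probability $s_n$, and each advertiser $a$ receives exactly $C_a$ impressions almost surely. Its expected yield is $\mathbb E\sum_{n=1}^N[r(s_n)+(1-s_n)Q_{n,a_n}]$. $J_N^*$ is the supremum of the expected yields of admissible policies. **Deterministic approximation.** $J_N^D$ is the supremum of $\sum_{n=1}^N\mathbb E[r(s_n(Q))+\sum_{a\in\mathcal A} i_{n,a}(Q)Q_a]$ over measurable $s_n,i_{n,a}\ge0$ with $\sum_{a\in\mathcal A} i_{n,a}+s_n\le1$ and $\sum_{n=1}^N\mathbb E[i_{n,a}(Q)]=N\rho_a$ for all $a\in\mathcal A$. ($J_1^D$ is the same with $N$ replaced by $1$ and the same $\rho$.) The dual problem is to minimize over $v\in\mathbb R^A$ $$\psi(v)=\mathbb E\,R\Big(\max_{a\in\mathcal A_0}\{Q_a-v_a\}\Big)+\sum_{a\in\mathcal A}v_a\rho_a,\qquad v_0=0 .$$ **The policy $\mu^B$.** Fix a dual optimal $v$, put $\lambda(Q)=\max_{a\in\mathcal A_0}\{Q_a-v_a\}$, and for non-empty $S\subseteq\mathcal A_0$ let $\mathbb P(S\text{-tie})=\mathbb E[(1-s^*(\lambda(Q)))\mathbf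 1\{\text{the set of maximizers of }Q_a-v_a\text{ over }\mathcal A_0\text{ is }S\}]$. A tie-breaking flow consists of numbers $y_a(S)\ge0$ ($a\in S$) with $\sum_{S\ni a}y_a(S)=\rho_a$ for $a\in\mathcal A$ and $\sum_{a\in S}y_a(S)=\mathbb P(S\text{-tie})$ for every non-empty $S$. Given such a flow, put $I_a(Q)=y_a(S)/\mathbb P(S\text{-tie})$ (read as $0$ if the denominator is $0$) if $S$ is the set of maximizers over $\mathcal A_0$ and $a\in S$, and $I_a(Q)=0$ otherwise. Let $m$ be the number of remaining impressions including the present one, let $x_a$ be the number still owed to advertiser $a$, and let $\mathcal A_n=\{a\in\mathcal A:x_a>0\}$. If $\sum_a x_a<m$, the eligible options are $\mathcal A_n\cup\{0\}$ and the impression is offered to AdX with acceptance probability $s^*(\max_{a\in\mathcal A_n\cup\{0\}}\{Q_{n,a}-v_a\})$. Otherwise the eligible options are $\mathcal A_n$ and the acceptance probability is $0$ (null price). If rejected, the impression goes to an option drawn from the set $T$ of eligible options that maximize $Q_{n,a}-v_a$, with probabilities $I_a(Q_n)/\sum_{a'\in T}I_{a'}(Q_n)$; if this denominator vanishes, it is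 drawn from an arbitrary fixed probability vector $\varphi_T$ on $T$. Let $J_N^B$ be the expected yield of $\mu^B$. **Theorem.** A dual optimal $v$ exists; if for every $c>0$ the maximizer of $s\mapsto r(s)+(1-s)c$ on $[0,1]$ is unique, then every dual optimal $v$ admits a tie-breaking flow. For every dual optimal $v$, every tie-breaking flow for $v$ and every family $(\varphi_T)$, put $$K(\rho)=\sqrt{\frac{A}{A+1}\sum_{a\in\mathcal A_0}\frac{1-\rho_a}{\rho_a}} .$$ Then: 1. $\mu^B$ is admissible, $J_N^B\le J_N^*\le J_N^D$ and $J_N^B\ge\big(1-\tfrac{1}{\sqrt N}K(\rho)\big)J_N^D$. If $J_N^D>0$, then $J_N^*>0$ and $$\frac{J_N^B}{J_N^*}\ \ge\ \frac{J_N^B}{J_N^D}\ \ge\ 1-\frac{1}{\sqrt N}K(\rho).$$ 2. $J_N^*-J_N^B\le\sqrt N\,K(\rho)\,J_1^D$, so the loss against the optimal online policy is $O(\sqrt N)$. 3. Let $r$, the law of $Q$, $\rho$, $v$, the flow and $(\varphi_T)$ be fixed, and let $N\to\infty$ along any sequence for which all the numbers $C_a=N\rho_a$ are integers. If $J_1^D>0$,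 then $J_N^B/J_N^*\to1$. -/

import Mathlib

open MeasureTheory

noncomputable section

namespace AdX

/-! ### The exchange

`r s` is the expected revenue collected when an impression is offered to the exchange at the
reserve price for which it is accepted with probability `s`. -/

/-- Regular revenue functions on `[0, 1]`. -/
structure IsRegular (r : ℝ → ℝ) : Prop where
  continuousOn : ContinuousOn r (Set.Icc 0 1)
  concaveOn : ConcaveOn ℝ (Set.Icc 0 1) r
  nonneg : ∀ s ∈ Set.Icc (0 : ℝ) 1, 0 ≤ r s
  bounded : ∃ M, ∀ s ∈ Set.Icc (0 : ℝ) 1, r s ≤ M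
  tendsto_zero : Filter.Tendsto r (nhdsWithin 0 (Set.Ioi 0)) (nhds 0)
  zero : r 0 = 0

/-- Expected gain `r s + (1 - s) c` at acceptance probability `s` and opportunity cost `c`. -/
def gain (r : ℝ → ℝ) (c s : ℝ) : ℝ := r s + (1 - s) * c

/-- The acceptance probabilities that maximize the expected gain at opportunity cost `c`. -/
def maximizers (r : ℝ → ℝ) (c : ℝ) : Set ℝ :=
  {s | s ∈ Set.Icc (0 : ℝ) 1 ∧ ∀ t ∈ Set.Icc (0 : ℝ) 1, gain r c t ≤ gain r c s}

/-- `R(c) = max_{0 ≤ s ≤ 1} r(s) + (1 - s) c`. -/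
def optGain (r : ℝ → ℝ) (c : ℝ) : ℝ := sSup (gain r c '' Set.Icc 0 1)

/-- `s*(c)`, the least maximizer. -/
def sStar (r : ℝ → ℝ) (c : ℝ) : ℝ := sInf (maximizers r c)

/-- At every positive opportunity cost the maximizer is unique. -/
def UniqueMaximizers (r : ℝ → ℝ) : Prop := ∀ c : ℝ, 0 < c → (maximizers r c).Subsingleton

/-! ### Advertisers

The advertisers are `Fin A`. In `Fin (A + 1)` the element `0` is the outside option (the impression
is discarded), and `a.succ` is advertiser `a`. -/

variable {A : ℕ}

/-- The capacity ratios `ρ`, extended by `ρ₀ = 1 - ∑ ρ_a`. -/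
def fullRatio (ρ : Fin A → ℝ) : Fin (A + 1) → ℝ :=
  Fin.cons (α := fun _ => ℝ) (1 - ∑ a, ρ a) ρ

/-- `K(ρ)`. -/
def K (ρ : Fin A → ℝ) : ℝ :=
  Real.sqrt ((A : ℝ) / ((A : ℝ) + 1) * ∑ a : Fin (A + 1), (1 - fullRatio ρ a) / fullRatio ρ a)

/-- Qualities, extended by quality zero for the outside option. -/
def quality (q : Fin A → ℝ) : Fin (A + 1) → ℝ := Fin.cons (α := fun _ => ℝ) 0 q

/-- The contract adjusted quality `Q_a - v_a`, with value zero for the outside option. -/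
def adjusted (v q : Fin A → ℝ) (a : Fin (A + 1)) : ℝ := quality q a - quality v a

/-- The largest contract adjusted quality over all of `A₀`. -/
def maxAdjusted (v q : Fin A → ℝ) : ℝ :=
  Finset.univ.sup' Finset.univ_nonempty (adjusted v q)

/-- The elements of `T` that maximize the contract adjusted quality over `T`. -/
def argmaxIn (v q : Fin A → ℝ) (T : Finset (Fin (A + 1))) : Finset (Fin (A + 1)) :=
  T.filter fun a => ∀ b ∈ T, adjusted v q b ≤ adjusted v q a

/-! ### The deterministic approximation problem and its dual -/

/-- The controls of one impression: acceptance probability `s` and assignment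
probabilities `i`, as functions of the quality vector. -/
structure IsControl (s : (Fin A → ℝ) → ℝ) (i : (Fin A → ℝ) → Fin A → ℝ) : Prop where
  measurable_s : Measurable s
  measurable_i : Measurable i
  s_nonneg : ∀ q, 0 ≤ s q
  i_nonneg : ∀ q a, 0 ≤ i q a
  sum_le_one : ∀ q, ∑ a, i q a + s q ≤ 1

/-- The objective values of the feasible points of the deterministic approximation problem with
`N` impressions. -/
def dapValues (G : Measure (Fin A → ℝ)) (r : ℝ → ℝ) (ρ : Fin A → ℝ) (N : ℕ) : Set ℝ :=
  {z | ∃ (s : Fin N → (Fin A → ℝ) → ℝ) (i : Fin N → (Fin A → ℝ) → Fin A → ℝ),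
    (∀ n, IsControl (s n) (i n)) ∧
    (∀ a, ∑ n, ∫ q, i n q a ∂G = N * ρ a) ∧
    z = ∑ n, ∫ q, (r (s n q) + ∑ a, i n q a * q a) ∂G}

/-- `J_N^D`. -/
def JD (G : Measure (Fin A → ℝ)) (r : ℝ → ℝ) (ρ : Fin A → ℝ) (N : ℕ) : ℝ :=
  sSup (dapValues G r ρ N)

/-- The dual objective `ψ(v) = E R(max_{a ∈ A₀} (Q_a - v_a)) + ∑ v_a ρ_a`. -/
def dual (G : Measure (Fin A → ℝ)) (r : ℝ → ℝ) (ρ v : Fin A → ℝ) : ℝ :=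
  ∫ q, optGain r (maxAdjusted v q) ∂G + ∑ a, v a * ρ a

/-- `v` is an optimal solution of the dual problem. -/
def IsDualOptimal (G : Measure (Fin A → ℝ)) (r : ℝ → ℝ) (ρ v : Fin A → ℝ) : Prop :=
  ∀ w, dual G r ρ v ≤ dual G r ρ w

/-! ### Ties -/

/-- The probability of an `S`-tie: the maximum over `A₀` is attained exactly on `S` and the
impression is rejected by the exchange. -/
def tieProb (G : Measure (Fin A → ℝ)) (r : ℝ → ℝ) (v : Fin A → ℝ)
    (S : Finset (Fin (A + 1))) : ℝ :=
  ∫ q, (if argmaxIn v q Finset.univ = S then 1 - sStar r (maxAdjusted v q) else 0) ∂G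

/-- A non-negative flow `y S a = y_a(S)` from ties to their members that meets the
capacity constraints and the tie probabilities. -/
structure IsTieFlow (G : Measure (Fin A → ℝ)) (r : ℝ → ℝ) (ρ v : Fin A → ℝ)
    (y : Finset (Fin (A + 1)) → Fin (A + 1) → ℝ) : Prop where
  nonneg : ∀ S, ∀ a ∈ S, 0 ≤ y S a
  capacity : ∀ a : Fin A, ∑ S with a.succ ∈ S, y S a.succ = ρ a
  prob : ∀ S : Finset (Fin (A + 1)), S.Nonempty → ∑ a ∈ S, y S a = tieProb G r v S

/-- The routing probability `I_a(Q)` on an `S`-tie. -/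
def routing (G : Measure (Fin A → ℝ)) (r : ℝ → ℝ) (v : Fin A → ℝ)
    (y : Finset (Fin (A + 1)) → Fin (A + 1) → ℝ) (S : Finset (Fin (A + 1))) (a : Fin (A + 1)) :
    ℝ :=
  if a ∈ S then y S a / tieProb G r v S else 0

/-- A family of probability vectors, one on each non-empty set of options. -/
structure IsFallback (φ : Finset (Fin (A + 1)) → Fin (A + 1) → ℝ) : Prop where
  nonneg : ∀ T, ∀ a ∈ T, 0 ≤ φ T a
  sum_eq_one : ∀ T : Finset (Fin (A + 1)), T.Nonempty → ∑ a ∈ T, φ T a = 1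

/-- The probability with which the option `a` is drawn when `T` is the set of maximizers among the
eligible options and `S` is the set of maximizers over `A₀`: the routing probabilities restricted
to `T` and normalized, and `φ T` when they vanish on `T`. -/
def drawProb (G : Measure (Fin A → ℝ)) (r : ℝ → ℝ) (v : Fin A → ℝ)
    (y φ : Finset (Fin (A + 1)) → Fin (A + 1) → ℝ) (S T : Finset (Fin (A + 1)))
    (a : Fin (A + 1)) : ℝ :=
  if a ∈ T then
    if ∑ b ∈ T, routing G r v y S b = 0 then φ T a
    else routing G r v y S a / ∑ b ∈ T, routing G r v y S b
  else 0

/-- Draws an option from the probability vector `p` by inversion of a uniform variable `w`. -/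
def draw (p : Fin (A + 1) → ℝ) (w : unitInterval) : Fin (A + 1) :=
  (Finset.univ.filter fun a => (w : ℝ) < ∑ b ∈ Finset.Iic a, p b).min.untopD 0

/-! ### Policies and the stochastic control problem -/

/-- An impression: its qualities, the uniform variable that decides acceptance by the exchange,
and a uniform variable available for randomized assignment. -/
abbrev Impression (A : ℕ) : Type := (Fin A → ℝ) × unitInterval × unitInterval

/-- The law of an i.i.d. sequence of impressions whose qualities have law `G`. -/
def pathLaw (G : Measure (Fin A → ℝ)) [IsProbabilityMeasure G] : Measure (ℕ → Impression A) :=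
  Measure.infinitePi fun _ : ℕ => G.prod ((volume : Measure unitInterval).prod volume)

/-- A control policy: at the impression with index `n = 0, 1, …` it chooses an acceptance
probability from the past impressions and the present qualities, and the option to which
the impression goes if it is rejected (this choice may be randomized). -/
structure Policy (A : ℕ) where
  accept : (n : ℕ) → (Fin n → Impression A) → (Fin A → ℝ) → ℝ
  target : (n : ℕ) → (Fin n → Impression A) → (Fin A → ℝ) → unitInterval → Fin (A + 1)

/-- The acceptance probability chosen at impression `n`. -/
def Policy.s (μ : Policy A) (n : ℕ) (ω : ℕ → Impression A) : ℝ :=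
  μ.accept n (fun i => ω i) (ω n).1

/-- The option chosen at impression `n` in case of rejection. -/
def Policy.choice (μ : Policy A) (n : ℕ) (ω : ℕ → Impression A) : Fin (A + 1) :=
  μ.target n (fun i => ω i) (ω n).1 (ω n).2.2

/-- Impression `n` is accepted by the exchange, which has conditional probability `μ.s n`. -/
def Policy.Accepted (μ : Policy A) (n : ℕ) (ω : ℕ → Impression A) : Prop :=
  ((ω n).2.1 : ℝ) < μ.s n ω

open Classical in
/-- The number of impressions assigned to advertiser `a` among the first `N`. -/
def Policy.assigned (μ : Policy A) (N : ℕ) (a : Fin A) (ω : ℕ → Impression A) : ℕ :=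
  ((Finset.range N).filter fun n => ¬ μ.Accepted n ω ∧ μ.choice n ω = a.succ).card

/-- Admissible policies for `N` impressions and contracts `C`. -/
structure Policy.IsAdmissible (μ : Policy A) (G : Measure (Fin A → ℝ)) [IsProbabilityMeasure G]
    (N : ℕ) (C : Fin A → ℕ) : Prop where
  measurable_accept : ∀ n, Measurable fun z : (Fin n → Impression A) × (Fin A → ℝ) =>
    μ.accept n z.1 z.2
  measurable_target : ∀ n, Measurable
    fun z : (Fin n → Impression A) × (Fin A → ℝ) × unitInterval => μ.target n z.1 z.2.1 z.2.2
  accept_mem : ∀ n h q, μ.accept n h q ∈ Set.Icc (0 : ℝ) 1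
  contracts : ∀ᵐ ω ∂pathLaw G, ∀ a, μ.assigned N a ω = C a

/-- The expected yield `E ∑_{n} [r(s_n) + (1 - s_n) ∑_a I_{n,a} Q_{n,a}]` of a policy. -/
def Policy.yield (μ : Policy A) (G : Measure (Fin A → ℝ)) [IsProbabilityMeasure G] (r : ℝ → ℝ)
    (N : ℕ) : ℝ :=
  ∫ ω, ∑ n ∈ Finset.range N,
    (r (μ.s n ω) + (1 - μ.s n ω) * quality (ω n).1 (μ.choice n ω)) ∂pathLaw G

/-- `J_N^*`, the optimal expected yield over all admissible policies. -/
def JStar (G : Measure (Fin A → ℝ)) [IsProbabilityMeasure G] (r : ℝ → ℝ) (N : ℕ)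
    (C : Fin A → ℕ) : ℝ :=
  sSup {z | ∃ μ : Policy A, μ.IsAdmissible G N C ∧ z = μ.yield G r N}

/-! ### The static bid-price policy

In a state `(m, x)`, `m` is the number of impressions that remain to arrive, including the present
one, and `x a` is the number of impressions still owed to advertiser `a`. -/

/-- The advertisers whose contracts are yet to be fulfilled. -/
def active (x : Fin A → ℕ) : Finset (Fin (A + 1)) :=
  (Finset.univ.filter fun a => 0 < x a).map (Fin.succEmb A)

/-- The options that may be chosen: the outside option is excluded when all the remaining
impressions are needed to fulfill the contracts. -/
def eligible (m : ℕ) (x : Fin A → ℕ) : Finset (Fin (A + 1)) :=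
  if ∑ a, x a < m then insert 0 (active x) else active x

/-- The acceptance probability in state `(m, x)`: the one of the price
`p*(max_{a ∈ A_n ∪ {0}} (Q_a - v_a))`, or zero (the null price) when all the remaining impressions
are needed. -/
def bidAccept (r : ℝ → ℝ) (v : Fin A → ℝ) (m : ℕ) (x : Fin A → ℕ) (q : Fin A → ℝ) : ℝ :=
  if ∑ a, x a < m then
    sStar r ((insert 0 (active x)).sup' (Finset.insert_nonempty _ _) (adjusted v q))
  else 0

/-- The option chosen in state `(m, x)` in case of rejection. -/
def bidTarget (G : Measure (Fin A → ℝ)) (r : ℝ → ℝ) (v : Fin A → ℝ)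
    (y φ : Finset (Fin (A + 1)) → Fin (A + 1) → ℝ) (m : ℕ) (x : Fin A → ℕ) (q : Fin A → ℝ)
    (w : unitInterval) : Fin (A + 1) :=
  draw (drawProb G r v y φ (argmaxIn v q Finset.univ) (argmaxIn v q (eligible m x))) w

/-- The number of impressions still owed to each advertiser after `n` impressions. -/
def remaining (G : Measure (Fin A → ℝ)) (r : ℝ → ℝ) (v : Fin A → ℝ)
    (y φ : Finset (Fin (A + 1)) → Fin (A + 1) → ℝ) (N : ℕ) (C : Fin A → ℕ) :
    (n : ℕ) → (Fin n → Impression A) → Fin A → ℕ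
  | 0, _ => C
  | n + 1, h =>
    let x := remaining G r v y φ N C n (Fin.init h)
    let z := h (Fin.last n)
    fun a =>
      if ¬ ((z.2.1 : ℝ) < bidAccept r v (N - n) x z.1) ∧
        bidTarget G r v y φ (N - n) x z.1 z.2.2 = a.succ
      then x a - 1 else x a

/-- The static bid-price policy with pricing, `μ^B`, with bid prices `v`, tie-breaking flow `y`
and fallback draws `φ`. -/
def bidPricePolicy (G : Measure (Fin A → ℝ)) (r : ℝ → ℝ) (v : Fin A → ℝ)
    (y φ : Finset (Fin (A + 1)) → Fin (A + 1) → ℝ) (N : ℕ) (C : Fin A → ℕ) : Policy A where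
  accept n h q := bidAccept r v (N - n) (remaining G r v y φ N C n h) q
  target n h q w := bidTarget G r v y φ (N - n) (remaining G r v y φ N C n h) q w

/-- `J_N^B`. -/
def JB (G : Measure (Fin A → ℝ)) [IsProbabilityMeasure G] (r : ℝ → ℝ) (v : Fin A → ℝ)
    (y φ : Finset (Fin (A + 1)) → Fin (A + 1) → ℝ) (N : ℕ) (C : Fin A → ℕ) : ℝ :=
  (bidPricePolicy G r v y φ N C).yield G r N

end AdX

end

namespace AdX

/-! ### The gain function, its maximum and its least maximizer -/

section Exchange

variable {r : ℝ → ℝ}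

/-! The argument compares everything with the dual value `dual G r ρ v`, written ψ(v).

Upper bound. Since Q_a = (Q_a - v_a) + v_a, one impression earns at most R(λ(Q)) plus v_a times the
probability of going to advertiser a. The contracts fix the sum of the second terms, so every
admissible policy (`Policy.IsAdmissible.yield_le`) and every feasible point of the deterministic
problem (`le_of_mem_dapValues`) is worth at most Nψ(v). Pricing at s*(λ(Q)) and routing ties by the
flow loses nothing in this bound and meets the capacities on average, so J_N^D = Nψ(v) (`JD_eq`).

Lower bound. While every contract is open and there is still room to discard, the policy applies
exactly this static control, and the present impression earns ψ(v) given the past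
(`integral_stepYield_of_isInterior`). Yields are non-negative, so J_N^B ≥ E[τ]ψ(v), with τ the
number of impressions met in such an interior state (`sum_integral_alive_mul_dual_le_JB`). It
remains to show N - E[τ] ≤ √N K(ρ) (`sub_le_sum_integral_alive`). An accepted impression counts as a
use of option 0. In interior states option a is then used at rate ρ_a, so its usage up to τ minus
ρ_a τ is a martingale value M_a with mean 0 and second moment ρ_a(1 - ρ_a)E[τ]
(`integral_totalDeviation`). Some option has been used at least Nρ_a times (`exists_le_usage`),
whence N - τ ≤ max_a M_a/ρ_a. The maximum of A + 1 numbers is bounded by their mean plus a multiple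
of their Euclidean norm (`le_mean_add_sqrt`); the mean has expectation zero, and Jensen together
with E[τ] ≤ N gives K(ρ).

Existence. ψ is continuous and coercive, hence attains its minimum (`exists_isDualOptimal`). A
tie-breaking flow exists because otherwise a hyperplane w would separate ρ from everything that
routing the ties can deliver, and -w would measure a strict violation of the first order condition
of v in direction w (`IsDualOptimal.sum_tieProb_mul_le`). Uniqueness of maximizers at positive costs
provides the continuity of s* needed for that derivative. -/

theorem IsRegular.continuousOn_gain (hr : IsRegular r) (c : ℝ) :
    ContinuousOn (gain r c) (Set.Icc 0 1) :=
  hr.continuousOn.add (by fun_prop)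

/-- Compactness is what makes the infimum defining `sStar` a maximizer itself. -/
theorem IsRegular.isCompact_maximizers (hr : IsRegular r) (c : ℝ) :
    IsCompact (maximizers r c) := by
  have h : maximizers r c =
      Set.Icc 0 1 ∩ gain r c ⁻¹' (⋂ t ∈ Set.Icc (0 : ℝ) 1, Set.Ici (gain r c t)) := by
    ext s; simp [maximizers]
  rw [h]
  exact isCompact_Icc.of_isClosed_subset
    ((hr.continuousOn_gain c).preimage_isClosed_of_isClosed isClosed_Icc
      (isClosed_biInter fun _ _ => isClosed_Ici)) Set.inter_subset_left

theorem IsRegular.maximizers_nonempty (hr : IsRegular r) (c : ℝ) : (maximizers r c).Nonempty := by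
  obtain ⟨s, hs, hmax⟩ := isCompact_Icc.exists_isMaxOn
    (Set.nonempty_Icc.2 (zero_le_one' ℝ)) (hr.continuousOn_gain c)
  exact ⟨s, hs, fun t ht => hmax ht⟩

theorem IsRegular.sStar_mem_maximizers (hr : IsRegular r) (c : ℝ) :
    sStar r c ∈ maximizers r c :=
  (hr.isCompact_maximizers c).sInf_mem (hr.maximizers_nonempty c)

theorem IsRegular.sStar_mem (hr : IsRegular r) (c : ℝ) : sStar r c ∈ Set.Icc (0 : ℝ) 1 :=
  (hr.sStar_mem_maximizers c).1

theorem IsRegular.sStar_le (hr : IsRegular r) {c s : ℝ} (hs : s ∈ maximizers r c) :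
    sStar r c ≤ s :=
  csInf_le (hr.isCompact_maximizers c).bddBelow hs

theorem optGain_eq_of_mem_maximizers {c s : ℝ} (hs : s ∈ maximizers r c) :
    optGain r c = gain r c s :=
  IsGreatest.csSup_eq ⟨⟨s, hs.1, rfl⟩, by rintro _ ⟨t, ht, rfl⟩; exact hs.2 t ht⟩

theorem IsRegular.gain_sStar (hr : IsRegular r) (c : ℝ) : gain r c (sStar r c) = optGain r c :=
  (optGain_eq_of_mem_maximizers (hr.sStar_mem_maximizers c)).symm

theorem IsRegular.gain_le_optGain (hr : IsRegular r) (c : ℝ) {s : ℝ} (hs : s ∈ Set.Icc (0 : ℝ) 1) :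
    gain r c s ≤ optGain r c := by
  rw [← hr.gain_sStar]
  exact (hr.sStar_mem_maximizers c).2 s hs

theorem IsRegular.le_optGain (hr : IsRegular r) (c : ℝ) : c ≤ optGain r c := by
  simpa [gain, hr.zero] using hr.gain_le_optGain c (s := 0) (by simp)

/-- The increment of `R` is controlled by the slope at the end point. -/
theorem IsRegular.optGain_sub_le (hr : IsRegular r) (c d : ℝ) :
    optGain r d - optGain r c ≤ (1 - sStar r d) * (d - c) := by
  have h := hr.gain_le_optGain c (hr.sStar_mem d)
  rw [← hr.gain_sStar d]
  simp only [gain] at h ⊢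
  linarith

theorem IsRegular.abs_optGain_sub_le (hr : IsRegular r) (c d : ℝ) :
    |optGain r d - optGain r c| ≤ |d - c| := by
  have key : ∀ c d : ℝ, optGain r d - optGain r c ≤ |d - c| := fun c d => by
    have hs := hr.sStar_mem d
    refine (hr.optGain_sub_le c d).trans ((le_abs_self _).trans ?_)
    rw [abs_mul, abs_of_nonneg (by linarith [hs.2])]
    exact mul_le_of_le_one_left (abs_nonneg _) (by linarith [hs.1])
  rw [abs_le]
  have h1 := key c d
  have h2 := key d c
  rw [abs_sub_comm] at h2
  constructor <;> linarith

theorem IsRegular.continuous_optGain (hr : IsRegular r) : Continuous (optGain r) := by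
  have : LipschitzWith 1 (optGain r) := LipschitzWith.of_dist_le_mul fun d c => by
    simpa [Real.dist_eq] using hr.abs_optGain_sub_le c d
  exact this.continuous

/-- Adding the two increment bounds for c to d and for d to c gives 0 ≤ (s*(c) - s*(d))(d - c).
Monotonicity also supplies the measurability of s*. -/
theorem IsRegular.sStar_antitone (hr : IsRegular r) : Antitone (sStar r) := by
  intro c d hcd
  rcases hcd.eq_or_lt with rfl | hlt
  · rfl
  have h1 := hr.optGain_sub_le c d
  have h2 := hr.optGain_sub_le d c
  nlinarith

theorem IsRegular.measurable_sStar (hr : IsRegular r) : Measurable (sStar r) :=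
  hr.sStar_antitone.measurable

/-- A regular revenue function composed with a measurable acceptance probability is measurable. -/
theorem IsRegular.measurable_comp (hr : IsRegular r) {α : Type*} [MeasurableSpace α] {s : α → ℝ}
    (hs : Measurable s) (hs' : ∀ x, s x ∈ Set.Icc (0 : ℝ) 1) : Measurable fun x => r (s x) := by
  exact (continuousOn_iff_continuous_domRestrict.1 hr.continuousOn).measurable.comp
    (hs.subtype_mk (h := hs'))

open Filter Topology in
/-- The least maximizer is continuous along sequences that end at a point of uniqueness, or that
approach their limit from the right. -/
theorem IsRegular.tendsto_sStar (hr : IsRegular r) {c : ℝ} {u : ℕ → ℝ} (hu : Tendsto u atTop (𝓝 c))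
    (h : (maximizers r c).Subsingleton ∨ ∀ᶠ k in atTop, c ≤ u k) :
    Tendsto (fun k => sStar r (u k)) atTop (𝓝 (sStar r c)) := by
  -- By compactness it suffices to identify each cluster point t. Continuity of r and R makes any
  -- such t a maximizer at c.
  refine isCompact_Icc.tendsto_nhds_of_unique_mapClusterPt (s := Set.Icc (0 : ℝ) 1)
    (Eventually.of_forall fun k => hr.sStar_mem _) ?_
  intro t ht hcl
  obtain ⟨φ, hφ, hlim⟩ := hcl.tendsto_subseq
  have hgain : ∀ k, gain r (u (φ k)) (sStar r (u (φ k))) = optGain r (u (φ k)) :=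
    fun k => hr.gain_sStar _
  have huφ : Tendsto (fun k => u (φ k)) atTop (𝓝 c) := hu.comp hφ.tendsto_atTop
  have hr_lim : Tendsto (fun k => r (sStar r (u (φ k)))) atTop (𝓝 (r t)) :=
    (hr.continuousOn t ht).tendsto.comp
      (tendsto_nhdsWithin_iff.2 ⟨hlim, Eventually.of_forall fun k => hr.sStar_mem _⟩)
  have h1 : Tendsto (fun k => gain r (u (φ k)) (sStar r (u (φ k)))) atTop (𝓝 (gain r c t)) :=
    hr_lim.add ((tendsto_const_nhds.sub hlim).mul huφ)
  have h2 : Tendsto (fun k => optGain r (u (φ k))) atTop (𝓝 (optGain r c)) :=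
    (hr.continuous_optGain.tendsto c).comp huφ
  simp only [hgain] at h1
  have heq : gain r c t = optGain r c := tendsto_nhds_unique h1 h2
  have htm : t ∈ maximizers r c := ⟨ht, fun s hs => heq ▸ hr.gain_le_optGain c hs⟩
  rcases h with h | h
  · exact h htm (hr.sStar_mem_maximizers c)
  -- From the right, monotonicity keeps the values at most s*(c), so t ≤ s*(c); t is a maximizer, so
  -- the least maximizer is at most t.
  · refine le_antisymm (le_of_tendsto hlim ?_) (hr.sStar_le htm)
    filter_upwards [hφ.tendsto_atTop.eventually h] with k hk using hr.sStar_antitone hk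

end Exchange

/-! ### Contract adjusted qualities -/

section Adjusted

variable {A : ℕ}

@[simp] theorem quality_zero (q : Fin A → ℝ) : quality q 0 = 0 := rfl

@[simp] theorem quality_succ (q : Fin A → ℝ) (a : Fin A) : quality q a.succ = q a := rfl

@[simp] theorem adjusted_zero (v q : Fin A → ℝ) : adjusted v q 0 = 0 := by simp [adjusted]

@[simp] theorem adjusted_succ (v q : Fin A → ℝ) (a : Fin A) :
    adjusted v q a.succ = q a - v a := rfl

theorem adjusted_le_maxAdjusted (v q : Fin A → ℝ) (a : Fin (A + 1)) :
    adjusted v q a ≤ maxAdjusted v q :=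
  Finset.le_sup' (adjusted v q) (Finset.mem_univ a)

theorem maxAdjusted_nonneg (v q : Fin A → ℝ) : 0 ≤ maxAdjusted v q := by
  simpa using adjusted_le_maxAdjusted v q 0

theorem adjusted_eq_maxAdjusted {v q : Fin A → ℝ} {a : Fin (A + 1)}
    (ha : a ∈ argmaxIn v q Finset.univ) : adjusted v q a = maxAdjusted v q := by
  simp only [argmaxIn, Finset.mem_filter] at ha
  exact le_antisymm (adjusted_le_maxAdjusted v q a) (Finset.sup'_le _ _ ha.2)

theorem mem_argmaxIn_univ {v q : Fin A → ℝ} {a : Fin (A + 1)} :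
    a ∈ argmaxIn v q Finset.univ ↔ adjusted v q a = maxAdjusted v q := by
  refine ⟨adjusted_eq_maxAdjusted, fun h => ?_⟩
  simp only [argmaxIn, Finset.mem_filter, Finset.mem_univ, true_and, true_implies]
  exact fun b => h ▸ adjusted_le_maxAdjusted v q b

theorem argmaxIn_subset (v q : Fin A → ℝ) (T : Finset (Fin (A + 1))) : argmaxIn v q T ⊆ T :=
  Finset.filter_subset _ _

theorem argmaxIn_nonempty (v q : Fin A → ℝ) {T : Finset (Fin (A + 1))} (hT : T.Nonempty) :
    (argmaxIn v q T).Nonempty := by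
  obtain ⟨a, ha, h⟩ := Finset.exists_max_image T (adjusted v q) hT
  exact ⟨a, Finset.mem_filter.2 ⟨ha, h⟩⟩

theorem measurable_quality (a : Fin (A + 1)) : Measurable fun q : Fin A → ℝ => quality q a := by
  refine Fin.cases ?_ (fun b => ?_) a
  · simp
  · simpa using measurable_pi_apply b

theorem measurable_adjusted (v : Fin A → ℝ) (a : Fin (A + 1)) :
    Measurable fun q => adjusted v q a :=
  (measurable_quality a).sub_const _

theorem measurable_sup'_adjusted (v : Fin A → ℝ) (T : Finset (Fin (A + 1))) (hT : T.Nonempty) :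
    Measurable fun q => T.sup' hT (adjusted v q) := by
  have h := Finset.measurable_sup' (f := fun a (q : Fin A → ℝ) => adjusted v q a) hT
    fun a _ => measurable_adjusted v a
  convert h using 1
  ext q
  simp [Finset.sup'_apply]

theorem measurable_maxAdjusted (v : Fin A → ℝ) : Measurable (maxAdjusted v) :=
  measurable_sup'_adjusted v _ _

theorem measurableSet_argmaxIn_eq (v : Fin A → ℝ) (T S : Finset (Fin (A + 1))) :
    MeasurableSet {q | argmaxIn v q T = S} := by
  have h : {q | argmaxIn v q T = S} =
      ⋂ a, {q | a ∈ S ↔ a ∈ T ∧ ∀ b, b ∈ T → adjusted v q b ≤ adjusted v q a} := by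
    ext q
    simp only [Set.mem_ofPred_eq, Set.mem_iInter, Finset.ext_iff, argmaxIn, Finset.mem_filter]
    exact forall_congr' fun a => Iff.comm
  rw [h]
  refine MeasurableSet.iInter fun a => ?_
  refine measurableSet_setOfPred.2 (measurable_const.iff (measurable_const.and
    (.forall fun b => measurable_const.imp ?_)))
  exact measurableSet_setOfPred.1
    (measurableSet_le (measurable_adjusted v b) (measurable_adjusted v a))

theorem abs_quality_le (q : Fin A → ℝ) (a : Fin (A + 1)) : |quality q a| ≤ ∑ b, |q b| := by
  refine Fin.cases ?_ (fun b => ?_) a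
  · simpa using Finset.sum_nonneg fun b _ => abs_nonneg (q b)
  · simpa using Finset.single_le_sum (f := fun b => |q b|) (fun b _ => abs_nonneg _)
      (Finset.mem_univ b)

theorem abs_maxAdjusted_le (v q : Fin A → ℝ) :
    |maxAdjusted v q| ≤ ∑ b, |q b| + ∑ b, |v b| := by
  rw [abs_of_nonneg (maxAdjusted_nonneg v q)]
  refine Finset.sup'_le _ _ fun a _ => ?_
  have h1 := (abs_le.1 (abs_quality_le q a)).2
  have h2 := (abs_le.1 (abs_quality_le v a)).1
  simp only [adjusted]
  linarith

theorem maxAdjusted_le_add (v w q : Fin A → ℝ) :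
    maxAdjusted v q ≤ maxAdjusted w q + ‖v - w‖ := by
  refine Finset.sup'_le _ _ fun a _ => ?_
  have h := adjusted_le_maxAdjusted w q a
  have h2 : quality w a - quality v a ≤ ‖v - w‖ := by
    refine Fin.cases (by simp) (fun b => ?_) a
    have := norm_le_pi_norm (v - w) b
    rw [Pi.sub_apply, Real.norm_eq_abs, abs_sub_comm] at this
    simpa using (le_abs_self _).trans this
  simp only [adjusted] at h ⊢
  linarith

theorem abs_maxAdjusted_sub_le (v w q : Fin A → ℝ) :
    |maxAdjusted v q - maxAdjusted w q| ≤ ‖v - w‖ := by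
  have h1 := maxAdjusted_le_add v w q
  have h2 := maxAdjusted_le_add w v q
  rw [norm_sub_rev] at h2
  rw [abs_le]
  constructor <;> linarith

variable {G : Measure (Fin A → ℝ)} {r : ℝ → ℝ}

theorem integrable_quality (hG : ∀ a, Integrable (fun q : Fin A → ℝ => q a) G)
    (a : Fin (A + 1)) : Integrable (fun q => quality q a) G := by
  refine Fin.cases ?_ (fun b => ?_) a
  · simp
  · simpa using hG b

theorem integrable_sum_abs (hG : ∀ a, Integrable (fun q : Fin A → ℝ => q a) G) :
    Integrable (fun q : Fin A → ℝ => ∑ b, |q b|) G :=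
  integrable_finsetSum _ fun b _ => (hG b).abs

theorem integrable_maxAdjusted [IsProbabilityMeasure G]
    (hG : ∀ a, Integrable (fun q : Fin A → ℝ => q a) G)
    (v : Fin A → ℝ) : Integrable (maxAdjusted v) G :=
  ((integrable_sum_abs hG).add (integrable_const (∑ b, |v b|))).mono'
    (measurable_maxAdjusted v).aestronglyMeasurable (.of_forall fun q => abs_maxAdjusted_le v q)

theorem IsRegular.integrable_optGain [IsProbabilityMeasure G] (hr : IsRegular r)
    (hG : ∀ a, Integrable (fun q : Fin A → ℝ => q a) G) (v : Fin A → ℝ) :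
    Integrable (fun q => optGain r (maxAdjusted v q)) G := by
  refine ((integrable_maxAdjusted hG v).abs.add (integrable_const |optGain r 0|)).mono'
    (hr.continuous_optGain.measurable.comp (measurable_maxAdjusted v)).aestronglyMeasurable
    (.of_forall fun q => ?_)
  have h := hr.abs_optGain_sub_le 0 (maxAdjusted v q)
  have h2 := abs_sub_abs_le_abs_sub (optGain r (maxAdjusted v q)) (optGain r 0)
  simp only [sub_zero, Real.norm_eq_abs, Pi.add_apply] at *
  linarith

end Adjusted

end AdX

namespace AdX

/-! ### Existence of dual optimal bid prices -/

section DualExistence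

variable {A : ℕ} {G : Measure (Fin A → ℝ)} [IsProbabilityMeasure G] {r : ℝ → ℝ} {ρ : Fin A → ℝ}

@[simp] theorem fullRatio_zero (ρ : Fin A → ℝ) : fullRatio ρ 0 = 1 - ∑ a, ρ a := rfl

@[simp] theorem fullRatio_succ (ρ : Fin A → ℝ) (a : Fin A) : fullRatio ρ a.succ = ρ a := rfl

theorem fullRatio_pos (hρ : ∀ a, 0 < ρ a) (hρ_sum : ∑ a, ρ a < 1) (a : Fin (A + 1)) :
    0 < fullRatio ρ a := by
  refine Fin.cases ?_ (fun b => ?_) a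
  · simpa using hρ_sum
  · simpa using hρ b

theorem sum_fullRatio (ρ : Fin A → ℝ) : ∑ a, fullRatio ρ a = 1 := by
  simp [Fin.sum_univ_succ]

theorem continuous_dual (hr : IsRegular r) (hG : ∀ a, Integrable (fun q : Fin A → ℝ => q a) G) :
    Continuous (dual G r ρ) := by
  have h : LipschitzWith 1 fun v => ∫ q, optGain r (maxAdjusted v q) ∂G := by
    refine LipschitzWith.of_dist_le_mul fun v w => ?_
    rw [Real.dist_eq, dist_eq_norm,
      ← integral_sub (hr.integrable_optGain hG v) (hr.integrable_optGain hG w)]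
    have := norm_integral_le_of_norm_le_const (μ := G)
      (f := fun q => optGain r (maxAdjusted v q) - optGain r (maxAdjusted w q)) (C := ‖v - w‖)
      (.of_forall fun q => (hr.abs_optGain_sub_le _ _).trans (abs_maxAdjusted_sub_le v w q))
    simpa using this
  exact h.continuous.add (by fun_prop)

/-- Non-negative qualities only raise the adjusted maximum, and R(c) ≥ c. What remains is an
explicit piecewise linear minorant of the dual objective. -/
theorem maxAdjusted_add_le_dual (hr : IsRegular r)
    (hG : ∀ a, Integrable (fun q : Fin A → ℝ => q a) G)
    (hG_nonneg : ∀ᵐ q ∂G, ∀ a, 0 ≤ q a) (v : Fin A → ℝ) :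
    maxAdjusted v 0 + ∑ a, v a * ρ a ≤ dual G r ρ v := by
  refine add_le_add_left ?_ _
  have h : ∫ _, maxAdjusted v 0 ∂G ≤ ∫ q, optGain r (maxAdjusted v q) ∂G := by
    refine integral_mono_ae (integrable_const _) (hr.integrable_optGain hG v) ?_
    filter_upwards [hG_nonneg] with q hq
    refine le_trans (Finset.sup'_le _ _ fun a _ => ?_) (hr.le_optGain _)
    refine le_trans ?_ (adjusted_le_maxAdjusted v q a)
    refine Fin.cases (by simp) (fun b => ?_) a
    simpa using hq b
  simpa using h

/-- Coercivity: the linear growth rate is the smallest of the A + 1 ratios, and it is positive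
because ρ₀ is positive too. -/
theorem exists_isDualOptimal (hr : IsRegular r)
    (hG : ∀ a, Integrable (fun q : Fin A → ℝ => q a) G) (hG_nonneg : ∀ᵐ q ∂G, ∀ a, 0 ≤ q a)
    (hρ : ∀ a, 0 < ρ a) (hρ_sum : ∑ a, ρ a < 1) : ∃ v, IsDualOptimal G r ρ v := by
  set c := Finset.univ.inf' Finset.univ_nonempty (fullRatio ρ) with hc_def
  have hc : 0 < c := (Finset.lt_inf'_iff _).2 fun a _ => fullRatio_pos hρ hρ_sum a
  have hc_le : ∀ a, c ≤ fullRatio ρ a := fun a => Finset.inf'_le _ (Finset.mem_univ a)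
  have hbound : ∀ v, c * ‖v‖ ≤ dual G r ρ v := by
    intro v
    refine le_trans ?_ (maxAdjusted_add_le_dual hr hG hG_nonneg v)
    set M := maxAdjusted v 0 with hM
    have hM0 : 0 ≤ M := maxAdjusted_nonneg v 0
    have hMv : ∀ a, 0 ≤ M + v a := fun a => by
      have := adjusted_le_maxAdjusted v 0 a.succ
      simp only [adjusted_succ, Pi.zero_apply] at this
      linarith
    -- Spreading M over the ratios, which sum to one, turns the minorant into a sum of non-negative
    -- terms. Each of them controls the part of v that it contains.
    have hsum : M + ∑ a, v a * ρ a = M * fullRatio ρ 0 + ∑ a, (M + v a) * ρ a := by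
      simp only [add_mul, Finset.sum_add_distrib, fullRatio_zero, ← Finset.mul_sum]
      ring
    have h0 : c * M ≤ M * fullRatio ρ 0 := by nlinarith [hc_le 0]
    have hterm : ∀ a, 0 ≤ (M + v a) * ρ a := fun a => mul_nonneg (hMv a) (hρ a).le
    rw [hsum, mul_comm c, ← le_div_iff₀ hc, pi_norm_le_iff_of_nonneg (div_nonneg
      (add_nonneg (le_trans (by positivity) h0) (Finset.sum_nonneg fun a _ => hterm a)) hc.le)]
    intro a
    rw [le_div_iff₀ hc, Real.norm_eq_abs]
    have h1 := Finset.single_le_sum (fun a _ => hterm a) (Finset.mem_univ a)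
    have h2 : c * (M + v a) ≤ (M + v a) * ρ a := by
      have := hc_le a.succ
      rw [fullRatio_succ] at this
      nlinarith [hMv a]
    have h3 := hMv a
    rcases abs_cases (v a) with ⟨h, _⟩ | ⟨h, _⟩ <;> rw [h] <;> nlinarith
  exact (continuous_dual hr hG).exists_forall_le (Filter.tendsto_atTop_mono hbound
    ((tendsto_norm_cocompact_atTop (E := Fin A → ℝ)).const_mul_atTop hc))

end DualExistence

/-! ### Tie probabilities -/

section Ties

variable {A : ℕ} {G : Measure (Fin A → ℝ)} [IsProbabilityMeasure G] {r : ℝ → ℝ} {ρ v : Fin A → ℝ}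

theorem IsRegular.measurable_sStar_maxAdjusted (hr : IsRegular r) (v : Fin A → ℝ) :
    Measurable fun q => sStar r (maxAdjusted v q) :=
  hr.measurable_sStar.comp (measurable_maxAdjusted v)

theorem IsRegular.measurable_tie (hr : IsRegular r) (v : Fin A → ℝ) (S : Finset (Fin (A + 1))) :
    Measurable fun q =>
      if argmaxIn v q Finset.univ = S then 1 - sStar r (maxAdjusted v q) else 0 :=
  Measurable.ite (measurableSet_argmaxIn_eq v _ S)
    ((hr.measurable_sStar_maxAdjusted v).const_sub 1) measurable_const

theorem IsRegular.tie_mem (hr : IsRegular r) (v q : Fin A → ℝ) (S : Finset (Fin (A + 1))) :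
    (if argmaxIn v q Finset.univ = S then 1 - sStar r (maxAdjusted v q) else 0) ∈
      Set.Icc (0 : ℝ) 1 := by
  have h := hr.sStar_mem (maxAdjusted v q)
  split_ifs
  · exact ⟨by linarith [h.2], by linarith [h.1]⟩
  · simp

theorem IsRegular.integrable_tie (hr : IsRegular r) (v : Fin A → ℝ) (S : Finset (Fin (A + 1))) :
    Integrable (fun q =>
      if argmaxIn v q Finset.univ = S then 1 - sStar r (maxAdjusted v q) else 0) G :=
  .of_bound (hr.measurable_tie v S).aestronglyMeasurable 1 (.of_forall fun q => by
    have h := hr.tie_mem v q S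
    rw [Real.norm_eq_abs, abs_of_nonneg h.1]
    exact h.2)

theorem IsRegular.tieProb_nonneg (hr : IsRegular r) (G : Measure (Fin A → ℝ)) (v : Fin A → ℝ)
    (S : Finset (Fin (A + 1))) : 0 ≤ tieProb G r v S :=
  integral_nonneg fun q => (hr.tie_mem v q S).1

theorem tieProb_empty (G : Measure (Fin A → ℝ)) (r : ℝ → ℝ) (v : Fin A → ℝ) :
    tieProb G r v ∅ = 0 := by
  have h : ∀ q, argmaxIn v q Finset.univ ≠ ∅ := fun q =>
    (argmaxIn_nonempty v q Finset.univ_nonempty).ne_empty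
  simp [tieProb, h]

/-- Functions of the set of maximizers are integrated over rejected impressions by summing over
ties. -/
theorem IsRegular.integral_tie (hr : IsRegular r) (v : Fin A → ℝ)
    (g : Finset (Fin (A + 1)) → ℝ) :
    ∫ q, (1 - sStar r (maxAdjusted v q)) * g (argmaxIn v q Finset.univ) ∂G =
      ∑ S, tieProb G r v S * g S := by
  simp only [tieProb, ← integral_mul_const]
  rw [← integral_finsetSum _ fun S _ => (hr.integrable_tie v S).mul_const _]
  refine integral_congr_ae (.of_forall fun q => ?_)
  simp [ite_mul]

/-! ### One-sided derivatives of the dual objective -/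

theorem adjusted_add_smul (v w q : Fin A → ℝ) (t : ℝ) (a : Fin (A + 1)) :
    adjusted (v + t • w) q a = adjusted v q a - t * quality w a := by
  refine Fin.cases (by simp) (fun b => ?_) a
  simp [sub_sub]

open Filter Topology

/-- For a fixed q and small t only the maximizers at v can compete, and among them the one whose
price rises least wins. The right derivative of the maximum is therefore minus the least w over the
maximizers, where option 0 counts with w₀ = 0. -/
theorem eventually_maxAdjusted_add_smul (v w q : Fin A → ℝ) {c : Fin (A + 1)}
    (hc : c ∈ argmaxIn v q Finset.univ)
    (hmin : ∀ b ∈ argmaxIn v q Finset.univ, quality w c ≤ quality w b) :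
    ∀ᶠ t in 𝓝[>] (0 : ℝ), maxAdjusted (v + t • w) q = maxAdjusted v q - t * quality w c := by
  have h : ∀ a, ∀ᶠ t in 𝓝[>] (0 : ℝ),
      adjusted v q a - t * quality w a ≤ maxAdjusted v q - t * quality w c := by
    intro a
    by_cases ha : a ∈ argmaxIn v q Finset.univ
    · filter_upwards [self_mem_nhdsWithin] with t ht
      rw [adjusted_eq_maxAdjusted ha]
      exact sub_le_sub_left (mul_le_mul_of_nonneg_left (hmin a ha) (le_of_lt ht)) _
    · have hlt : adjusted v q a < maxAdjusted v q :=
        (adjusted_le_maxAdjusted v q a).lt_of_ne fun h => ha (mem_argmaxIn_univ.2 h)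
      have h1 : Tendsto (fun t : ℝ => adjusted v q a - t * quality w a) (𝓝[>] 0)
          (𝓝 (adjusted v q a)) := by
        have : Continuous fun t : ℝ => adjusted v q a - t * quality w a := by fun_prop
        simpa using (this.tendsto 0).mono_left nhdsWithin_le_nhds
      have h2 : Tendsto (fun t : ℝ => maxAdjusted v q - t * quality w c) (𝓝[>] 0)
          (𝓝 (maxAdjusted v q)) := by
        have : Continuous fun t : ℝ => maxAdjusted v q - t * quality w c := by fun_prop
        simpa using (this.tendsto 0).mono_left nhdsWithin_le_nhds
      filter_upwards [h1.eventually_lt h2 hlt] with t ht using ht.le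
  filter_upwards [eventually_all.2 h] with t ht
  refine le_antisymm (Finset.sup'_le _ _ fun a _ => ?_) ?_
  · rw [adjusted_add_smul]
    exact ht a
  · have := adjusted_le_maxAdjusted (v + t • w) q c
    rwa [adjusted_add_smul, adjusted_eq_maxAdjusted hc] at this

/-- First order optimality of the bid prices in the direction `w`. -/
theorem IsDualOptimal.sum_tieProb_mul_le (hv : IsDualOptimal G r ρ v) (hr : IsRegular r)
    (hG : ∀ a, Integrable (fun q : Fin A → ℝ => q a) G) (hu : UniqueMaximizers r) (w : Fin A → ℝ)
    {c : Finset (Fin (A + 1)) → Fin (A + 1)}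
    (hc : ∀ S : Finset (Fin (A + 1)), S.Nonempty →
      c S ∈ S ∧ ∀ b ∈ S, quality w (c S) ≤ quality w b) :
    ∑ S, tieProb G r v S * quality w (c S) ≤ ∑ a, w a * ρ a := by
  set t : ℕ → ℝ := fun k => 1 / ((k : ℝ) + 1) with ht_def
  have ht_pos : ∀ k, 0 < t k := fun k => by positivity
  have ht : Tendsto t atTop (𝓝[>] 0) :=
    tendsto_nhdsWithin_iff.2 ⟨tendsto_one_div_add_atTop_nhds_zero_nat, .of_forall ht_pos⟩
  have ht0 : Tendsto t atTop (𝓝 0) := ht.mono_right nhdsWithin_le_nhds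
  -- The slope of R is taken at the perturbed point: this bounds the difference quotient of R from
  -- above, which is the direction that optimality of v needs, at the price of a limit of s*.
  set f : ℕ → (Fin A → ℝ) → ℝ := fun k q =>
    (1 - sStar r (maxAdjusted (v + t k • w) q)) *
      ((maxAdjusted (v + t k • w) q - maxAdjusted v q) / t k) with hf_def
  have hnorm : ∀ k q, |maxAdjusted (v + t k • w) q - maxAdjusted v q| ≤ t k * ‖w‖ := fun k q => by
    refine (abs_maxAdjusted_sub_le _ _ q).trans_eq ?_
    simp [norm_smul, abs_of_pos (ht_pos k)]
  have hf_meas : ∀ k, Measurable (f k) := fun k =>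
    ((hr.measurable_sStar_maxAdjusted _).const_sub 1).mul
      (((measurable_maxAdjusted _).sub (measurable_maxAdjusted _)).div_const _)
  have hf_bound : ∀ k q, ‖f k q‖ ≤ ‖w‖ := fun k q => by
    have hs := hr.sStar_mem (maxAdjusted (v + t k • w) q)
    rw [Real.norm_eq_abs, abs_mul, abs_div, abs_of_pos (ht_pos k),
      abs_of_nonneg (by linarith [hs.2])]
    refine (mul_le_of_le_one_left (by have := ht_pos k; positivity) (by linarith [hs.1])).trans ?_
    rw [div_le_iff₀ (ht_pos k), mul_comm]
    exact hnorm k q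
  have hlim : Tendsto (fun k => ∫ q, f k q ∂G) atTop
      (𝓝 (∫ q, (1 - sStar r (maxAdjusted v q)) *
        (-quality w (c (argmaxIn v q Finset.univ))) ∂G)) := by
    refine tendsto_integral_of_dominated_convergence (fun _ => ‖w‖)
      (fun k => (hf_meas k).aestronglyMeasurable) (integrable_const _)
      (fun k => .of_forall (hf_bound k)) (.of_forall fun q => ?_)
    have hmax : Tendsto (fun k => maxAdjusted (v + t k • w) q) atTop (𝓝 (maxAdjusted v q)) := by
      rw [tendsto_iff_dist_tendsto_zero]
      refine squeeze_zero (fun _ => dist_nonneg) (fun k => ?_)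
        (by simpa using ht0.mul_const ‖w‖)
      exact hnorm k q
    refine ((hr.tendsto_sStar hmax ?_).const_sub 1).mul ?_
    -- At λ(q) > 0 the maximizer is unique. At λ(q) = 0 uniqueness is not available, but the
    -- perturbed maxima are non-negative as well, so they approach 0 from the right.
    · rcases (maxAdjusted_nonneg v q).eq_or_lt with h | h
      · exact Or.inr (.of_forall fun k => h ▸ maxAdjusted_nonneg _ q)
      · exact Or.inl (hu _ h)
    · have hcq := hc _ (argmaxIn_nonempty v q Finset.univ_nonempty)
      refine tendsto_const_nhds.congr' ?_
      filter_upwards [ht.eventually (eventually_maxAdjusted_add_smul v w q hcq.1 hcq.2)] with k hk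
      rw [hk]
      field_simp [(ht_pos k).ne']
      ring
  have hstep : ∀ k, -∑ a, w a * ρ a ≤ ∫ q, f k q ∂G := fun k => by
    have h1 := hv (v + t k • w)
    have h2 : ∫ q, optGain r (maxAdjusted (v + t k • w) q) ∂G -
        ∫ q, optGain r (maxAdjusted v q) ∂G ≤ t k * ∫ q, f k q ∂G := by
      rw [← integral_sub (hr.integrable_optGain hG _) (hr.integrable_optGain hG _),
        ← integral_const_mul]
      refine integral_mono ((hr.integrable_optGain hG _).sub (hr.integrable_optGain hG _))
        ((Integrable.of_bound (hf_meas k).aestronglyMeasurable ‖w‖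
          (.of_forall (hf_bound k))).const_mul _) fun q => ?_
      refine (hr.optGain_sub_le _ _).trans_eq ?_
      simp only [hf_def]
      field_simp [(ht_pos k).ne']
    have h3 : ∑ a, (v + t k • w) a * ρ a = ∑ a, v a * ρ a + t k * ∑ a, w a * ρ a := by
      rw [Finset.mul_sum, ← Finset.sum_add_distrib]
      exact Finset.sum_congr rfl fun a _ => by simp; ring
    simp only [dual, h3] at h1
    have h4 : 0 ≤ t k * (∫ q, f k q ∂G + ∑ a, w a * ρ a) := by linarith
    have := nonneg_of_mul_nonneg_right h4 (ht_pos k)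
    linarith
  have h := ge_of_tendsto' hlim hstep
  rw [hr.integral_tie v fun S => -quality w (c S)] at h
  simp only [mul_neg, Finset.sum_neg_distrib] at h
  linarith

/-! ### Existence of a tie-breaking flow by separation -/

/-- The flows out of the ties that have the right total from each tie. -/
def tieFlows (G : Measure (Fin A → ℝ)) (r : ℝ → ℝ) (v : Fin A → ℝ) :
    Set (Finset (Fin (A + 1)) → Fin (A + 1) → ℝ) :=
  {y | ∀ S, (∀ a, 0 ≤ y S a) ∧ (∀ a, a ∉ S → y S a = 0) ∧ ∑ a, y S a = tieProb G r v S}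

theorem isCompact_tieFlows (G : Measure (Fin A → ℝ)) (r : ℝ → ℝ) (v : Fin A → ℝ) :
    IsCompact (tieFlows G r v) := by
  refine (isCompact_Icc (a := fun _ _ => (0 : ℝ))
    (b := fun S _ => tieProb G r v S)).of_isClosed_subset ?_ ?_
  · simp only [tieFlows, Set.ofPred_forall, Set.ofPred_and]
    refine isClosed_iInter fun S => ((isClosed_iInter fun a => ?_).inter
      ((isClosed_iInter fun a => isClosed_iInter fun _ => ?_).inter ?_))
    · exact isClosed_le continuous_const (by fun_prop)
    · exact isClosed_eq (by fun_prop) continuous_const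
    · exact isClosed_eq (by fun_prop) continuous_const
  · intro y hy
    refine ⟨fun S a => (hy S).1 a, fun S a => ?_⟩
    exact (Finset.single_le_sum (fun b _ => (hy S).1 b) (Finset.mem_univ a)).trans_eq (hy S).2.2

theorem convex_tieFlows (G : Measure (Fin A → ℝ)) (r : ℝ → ℝ) (v : Fin A → ℝ) :
    Convex ℝ (tieFlows G r v) := by
  intro y hy z hz s t hs ht hst S
  refine ⟨fun a => add_nonneg (mul_nonneg hs ((hy S).1 a)) (mul_nonneg ht ((hz S).1 a)),
    fun a ha => ?_, ?_⟩
  · simp [(hy S).2.1 a ha, (hz S).2.1 a ha]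
  · simp only [Pi.add_apply, Pi.smul_apply, smul_eq_mul, Finset.sum_add_distrib, ← Finset.mul_sum,
      (hy S).2.2, (hz S).2.2, ← add_mul, hst, one_mul]

/-- What the advertisers receive from a flow out of the ties. -/
def received (A : ℕ) : (Finset (Fin (A + 1)) → Fin (A + 1) → ℝ) →ₗ[ℝ] Fin A → ℝ where
  toFun y a := ∑ S, y S a.succ
  map_add' y z := by ext a; simp [Finset.sum_add_distrib]
  map_smul' t y := by ext a; simp [Finset.mul_sum]

/-- What the advertisers can receive forms a compact convex set. If it missed ρ, a functional w
would be strictly larger on it than at ρ. The flow that is cheapest for w contradicts this by the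
first order condition in direction w. -/
theorem IsDualOptimal.exists_isTieFlow (hv : IsDualOptimal G r ρ v) (hr : IsRegular r)
    (hG : ∀ a, Integrable (fun q : Fin A → ℝ => q a) G) (hu : UniqueMaximizers r) :
    ∃ y, IsTieFlow G r ρ v y := by
  by_cases hmem : ρ ∈ received A '' tieFlows G r v
  · obtain ⟨y, hy, hyρ⟩ := hmem
    refine ⟨y, fun S a _ => (hy S).1 a, fun a => ?_, fun S _ => ?_⟩
    · rw [← hyρ]
      refine Finset.sum_subset (Finset.filter_subset _ _) fun S _ hS => (hy S).2.1 _ ?_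
      simpa using hS
    · rw [← (hy S).2.2]
      exact Finset.sum_subset (Finset.subset_univ _) fun a _ ha => (hy S).2.1 a ha
  · exfalso
    obtain ⟨f, u, hfρ, hf⟩ := geometric_hahn_banach_point_closed
      ((convex_tieFlows G r v).linear_image (received A))
      ((isCompact_tieFlows G r v).image (received A).continuous_of_finiteDimensional).isClosed hmem
    set w : Fin A → ℝ := fun a => f (Pi.single a 1) with hw
    have hfw : ∀ x, f x = ∑ a, w a * x a := fun x => by
      conv_lhs => rw [← Finset.univ_sum_single x]
      rw [map_sum]
      refine Finset.sum_congr rfl fun a _ => ?_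
      have : Pi.single a (x a) = x a • (Pi.single a 1 : Fin A → ℝ) := by
        rw [← Pi.single_smul]; simp
      rw [this, map_smul, smul_eq_mul, mul_comm]
    have hex : ∀ S : Finset (Fin (A + 1)), ∃ c, S.Nonempty →
        c ∈ S ∧ ∀ b ∈ S, quality w c ≤ quality w b := fun S => by
      rcases S.eq_empty_or_nonempty with rfl | hS
      · exact ⟨0, by simp⟩
      · obtain ⟨c, hc⟩ := S.exists_min_image (quality w) hS
        exact ⟨c, fun _ => hc⟩
    choose c hc using hex
    -- Every tie is sent entirely to a member with the least price w. The empty tie has probability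
    -- zero, so its arbitrary choice of `c` does no harm.
    set y : Finset (Fin (A + 1)) → Fin (A + 1) → ℝ :=
      fun S a => if a = c S then tieProb G r v S else 0 with hy_def
    have hy : y ∈ tieFlows G r v := fun S => by
      refine ⟨fun a => ?_, fun a ha => ?_, by simp [hy_def]⟩
      · simp only [hy_def]
        split_ifs
        exacts [hr.tieProb_nonneg G v S, le_rfl]
      · simp only [hy_def, ite_eq_right_iff]
        rintro rfl
        rcases S.eq_empty_or_nonempty with rfl | hS
        · exact tieProb_empty G r v
        · exact absurd (hc S hS).1 ha
    have h1 := hf _ ⟨y, hy, rfl⟩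
    have h2 := hv.sum_tieProb_mul_le hr hG hu w hc
    have h3 : f (received A y) = ∑ S, tieProb G r v S * quality w (c S) := by
      rw [hfw]
      have : ∀ S, ∑ a, quality w a * y S a = tieProb G r v S * quality w (c S) := fun S => by
        simp [hy_def, mul_comm]
      simp only [← this, Fin.sum_univ_succ, quality_zero, zero_mul, zero_add, quality_succ]
      rw [Finset.sum_comm]
      exact Finset.sum_congr rfl fun a _ => by simp [received, Finset.mul_sum]
    rw [hfw] at hfρ
    linarith

end Ties

end AdX

namespace AdX

/-! ### Drawing by inversion -/

section Draw

variable {A : ℕ} {p : Fin (A + 1) → ℝ}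

theorem Iio_succ_eq_Iic_castSucc (a : Fin A) : Finset.Iio a.succ = Finset.Iic a.castSucc := by
  ext b
  simp [Fin.lt_def, Fin.le_def]

/-- Inversion assigns to a the half-open interval between consecutive partial sums. At w = 1 the
defining set may be empty and the default 0 takes over, so that null case is excluded. -/
theorem draw_eq_iff (hp : ∀ a, 0 ≤ p a) (hsum : ∑ a, p a = 1) {w : unitInterval} (hw : (w : ℝ) < 1)
    (a : Fin (A + 1)) :
    draw p w = a ↔ ∑ b ∈ Finset.Iio a, p b ≤ w ∧ (w : ℝ) < ∑ b ∈ Finset.Iic a, p b := by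
  set F := Finset.univ.filter fun a => (w : ℝ) < ∑ b ∈ Finset.Iic a, p b with hF
  have hlast : Fin.last A ∈ F := by
    have : Finset.Iic (Fin.last A) = Finset.univ := by ext b; simp [Fin.le_last]
    simp [hF, this, hsum, hw]
  obtain ⟨m, hm⟩ := Finset.min_of_mem hlast
  have hdraw : draw p w = m := by simp [draw, ← hF, hm]
  have hmF : (w : ℝ) < ∑ b ∈ Finset.Iic m, p b := (Finset.mem_filter.1 (Finset.mem_of_min hm)).2
  rw [hdraw]
  constructor
  · rintro rfl
    refine ⟨?_, hmF⟩
    revert hm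
    refine Fin.cases (fun _ => ?_) (fun b hm => ?_) m
    · have : Finset.Iio (0 : Fin (A + 1)) = ∅ := by ext; simp
      simpa [this] using w.2.1
    · rw [Iio_succ_eq_Iic_castSucc]
      by_contra! h
      have := Finset.min_le_of_eq (Finset.mem_filter.2 ⟨Finset.mem_univ b.castSucc, h⟩) hm
      exact absurd this (by simp)
  · rintro ⟨h1, h2⟩
    refine le_antisymm (Finset.min_le_of_eq (Finset.mem_filter.2 ⟨Finset.mem_univ a, h2⟩) hm) ?_
    by_contra! h
    have hsub : Finset.Iic m ⊆ Finset.Iio a := fun b hb =>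
      Finset.mem_Iio.2 ((Finset.mem_Iic.1 hb).trans_lt h)
    have := Finset.sum_le_sum_of_subset_of_nonneg hsub fun b _ _ => hp b
    linarith

theorem sum_Iic_eq (p : Fin (A + 1) → ℝ) (a : Fin (A + 1)) :
    ∑ b ∈ Finset.Iic a, p b = ∑ b ∈ Finset.Iio a, p b + p a := by
  rw [← Finset.Iio_insert, Finset.sum_insert (by simp), add_comm]

/-- The strict upper end of the interval rules out options of probability zero for every w < 1, not
merely almost surely. This keeps the policy within its eligible options. -/
theorem draw_pos (hp : ∀ a, 0 ≤ p a) (hsum : ∑ a, p a = 1) {w : unitInterval} (hw : (w : ℝ) < 1) :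
    0 < p (draw p w) := by
  have h := (draw_eq_iff hp hsum hw _).1 rfl
  rw [sum_Iic_eq] at h
  linarith

theorem measurable_draw (p : Fin (A + 1) → ℝ) : Measurable (draw p) := by
  let _ : MeasurableSpace (Finset (Fin (A + 1))) := ⊤
  have h : Measurable fun w : unitInterval =>
      Finset.univ.filter fun a => (w : ℝ) < ∑ b ∈ Finset.Iic a, p b := by
    refine measurable_to_countable' fun S => ?_
    have : (fun w : unitInterval =>
        Finset.univ.filter fun a => (w : ℝ) < ∑ b ∈ Finset.Iic a, p b) ⁻¹' {S} =
        ⋂ a, {w : unitInterval | a ∈ S ↔ (w : ℝ) < ∑ b ∈ Finset.Iic a, p b} := by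
      ext w
      simp only [Set.mem_preimage, Set.mem_singleton_iff, Finset.ext_iff, Finset.mem_filter,
        Finset.mem_univ, true_and, Set.mem_iInter, Set.mem_ofPred_eq]
      exact forall_congr' fun a => Iff.comm
    rw [this]
    refine MeasurableSet.iInter fun a => measurableSet_setOfPred.2 (measurable_const.iff ?_)
    exact measurableSet_setOfPred.1 (measurableSet_lt measurable_subtype_coe measurable_const)
  exact (measurable_from_top (f := fun F : Finset (Fin (A + 1)) => F.min.untopD 0)).comp h

theorem ae_lt_one : ∀ᵐ w : unitInterval, (w : ℝ) < 1 := by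
  have h : ∀ᵐ w : unitInterval, w ≠ 1 := by
    simp [ae_iff]
  filter_upwards [h] with w hw
  exact lt_of_le_of_ne w.2.2 fun h => hw (Subtype.ext h)

theorem measureReal_draw (hp : ∀ a, 0 ≤ p a) (hsum : ∑ a, p a = 1) (a : Fin (A + 1)) :
    (volume : Measure unitInterval).real {w | draw p w = a} = p a := by
  have hlo : 0 ≤ ∑ b ∈ Finset.Iio a, p b := Finset.sum_nonneg fun b _ => hp b
  have hhi : ∑ b ∈ Finset.Iic a, p b ≤ 1 :=
    hsum ▸ Finset.sum_le_sum_of_subset_of_nonneg (Finset.subset_univ _) fun b _ _ => hp b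
  have hadd := sum_Iic_eq p a
  have hpa := hp a
  have hae : {w | draw p w = a} =ᵐ[(volume : Measure unitInterval)]
      Set.Ico (⟨∑ b ∈ Finset.Iio a, p b, hlo, by linarith⟩ : unitInterval)
        ⟨∑ b ∈ Finset.Iic a, p b, by linarith, hhi⟩ := by
    filter_upwards [ae_lt_one] with w hw
    exact propext (draw_eq_iff hp hsum hw a)
  rw [measureReal_congr hae, measureReal_def, unitInterval.volume_Ico]
  simp [hadd, hpa]

theorem integral_draw (hp : ∀ a, 0 ≤ p a) (hsum : ∑ a, p a = 1) (g : Fin (A + 1) → ℝ) :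
    ∫ w, g (draw p w) = ∑ a, p a * g a := by
  have hms : ∀ a, MeasurableSet {w | draw p w = a} := fun a =>
    measurable_draw p (measurableSet_singleton a)
  have h : ∀ w, g (draw p w) = ∑ a, {w | draw p w = a}.indicator (fun _ => g a) w := fun w => by
    simp [Set.indicator_apply]
  simp only [h]
  rw [integral_finsetSum _ fun a _ => (integrable_const (g a)).indicator (hms a)]
  refine Finset.sum_congr rfl fun a _ => ?_
  rw [integral_indicator_const _ (hms a), measureReal_draw hp hsum, smul_eq_mul]

end Draw

/-! ### The routing of a rejected impression -/

section Routing

variable {A : ℕ} {G : Measure (Fin A → ℝ)} {r : ℝ → ℝ} {ρ v : Fin A → ℝ}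
  {y φ : Finset (Fin (A + 1)) → Fin (A + 1) → ℝ}

theorem drawProb_of_notMem {S T : Finset (Fin (A + 1))} {a : Fin (A + 1)} (ha : a ∉ T) :
    drawProb G r v y φ S T a = 0 := by
  simp [drawProb, ha]

theorem routing_nonneg (hr : IsRegular r) (hy : IsTieFlow G r ρ v y) (S : Finset (Fin (A + 1)))
    (a : Fin (A + 1)) : 0 ≤ routing G r v y S a := by
  simp only [routing]
  split_ifs with h
  · exact div_nonneg (hy.nonneg S a h) (hr.tieProb_nonneg G v S)
  · rfl

theorem drawProb_nonneg (hr : IsRegular r) (hy : IsTieFlow G r ρ v y) (hφ : IsFallback φ)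
    (S T : Finset (Fin (A + 1))) (a : Fin (A + 1)) : 0 ≤ drawProb G r v y φ S T a := by
  simp only [drawProb]
  split_ifs with h1 h2
  · exact hφ.nonneg T a h1
  · exact div_nonneg (routing_nonneg hr hy S a)
      (Finset.sum_nonneg fun b _ => routing_nonneg hr hy S b)
  · rfl

theorem sum_drawProb (hφ : IsFallback φ) (S : Finset (Fin (A + 1))) {T : Finset (Fin (A + 1))}
    (hT : T.Nonempty) : ∑ a, drawProb G r v y φ S T a = 1 := by
  rw [← Finset.sum_subset (Finset.subset_univ T) fun a _ ha => drawProb_of_notMem ha]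
  by_cases h : ∑ b ∈ T, routing G r v y S b = 0
  · rw [← hφ.sum_eq_one T hT]
    exact Finset.sum_congr rfl fun a ha => by simp [drawProb, ha, h]
  · rw [← div_self h, Finset.sum_div]
    exact Finset.sum_congr rfl fun a ha => by simp [drawProb, ha, h]

/-- Routing according to the tie-breaking flow reproduces the flow. -/
theorem tieProb_mul_drawProb (hy : IsTieFlow G r ρ v y)
    (S : Finset (Fin (A + 1))) (a : Fin (A + 1)) :
    tieProb G r v S * drawProb G r v y φ S S a = if a ∈ S then y S a else 0 := by
  split_ifs with ha
  · have hprob := hy.prob S ⟨a, ha⟩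
    -- On a null tie the flow vanishes with its total. Otherwise the routing probabilities already
    -- sum to one on S, so neither normalization nor fallback intervenes.
    by_cases h : tieProb G r v S = 0
    · rw [h, Finset.sum_eq_zero_iff_of_nonneg (hy.nonneg S)] at hprob
      rw [h, zero_mul, hprob a ha]
    · have hsum : ∑ b ∈ S, routing G r v y S b = 1 := by
        rw [← div_self h]
        conv_rhs => rw [← hprob, Finset.sum_div]
        exact Finset.sum_congr rfl fun b hb => by simp [routing, hb, hprob]
      rw [drawProb, if_pos ha, hsum, if_neg one_ne_zero, div_one, routing, if_pos ha]
      field_simp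
  · rw [drawProb_of_notMem ha, mul_zero]

theorem integral_rejected_drawProb [IsProbabilityMeasure G] (hr : IsRegular r)
    (hy : IsTieFlow G r ρ v y) (a : Fin A) :
    ∫ q, (1 - sStar r (maxAdjusted v q)) *
      drawProb G r v y φ (argmaxIn v q Finset.univ) (argmaxIn v q Finset.univ) a.succ ∂G = ρ a := by
  rw [hr.integral_tie v fun S => drawProb G r v y φ S S a.succ]
  simp only [tieProb_mul_drawProb hy]
  rw [← Finset.sum_filter, hy.capacity]

/-- Only maximizers are drawn, and on these Q_a equals the common adjusted value plus v_a. -/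
theorem sum_drawProb_mul_quality (hφ : IsFallback φ) (q : Fin A → ℝ) :
    ∑ a, drawProb G r v y φ (argmaxIn v q Finset.univ) (argmaxIn v q Finset.univ) a * quality q a =
      maxAdjusted v q + ∑ a : Fin A,
        drawProb G r v y φ (argmaxIn v q Finset.univ) (argmaxIn v q Finset.univ) a.succ * v a := by
  set S := argmaxIn v q Finset.univ
  have hS : S.Nonempty := argmaxIn_nonempty v q Finset.univ_nonempty
  have h : ∀ a, drawProb G r v y φ S S a * quality q a =
      drawProb G r v y φ S S a * maxAdjusted v q + drawProb G r v y φ S S a * quality v a := by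
    intro a
    by_cases ha : a ∈ S
    · rw [← adjusted_eq_maxAdjusted ha, adjusted]; ring
    · simp [drawProb_of_notMem ha]
  simp only [h, Finset.sum_add_distrib, ← Finset.sum_mul, sum_drawProb hφ S hS, one_mul]
  rw [Fin.sum_univ_succ (fun a => drawProb G r v y φ S S a * quality v a)]
  simp

/-- Functions of the set of maximizers are measurable. -/
theorem measurable_comp_argmaxIn {β : Type*} [MeasurableSpace β] (v : Fin A → ℝ)
    (T : Finset (Fin (A + 1))) (g : Finset (Fin (A + 1)) → β) :
    Measurable fun q => g (argmaxIn v q T) := by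
  let _ : MeasurableSpace (Finset (Fin (A + 1))) := ⊤
  exact (measurable_from_top (f := g)).comp
    (measurable_to_countable' fun S => measurableSet_argmaxIn_eq v T S)

theorem drawProb_le_one (hr : IsRegular r) (hy : IsTieFlow G r ρ v y) (hφ : IsFallback φ)
    (S : Finset (Fin (A + 1))) (T : Finset (Fin (A + 1))) (a : Fin (A + 1)) :
    drawProb G r v y φ S T a ≤ 1 := by
  rcases T.eq_empty_or_nonempty with rfl | hT
  · simp [drawProb]
  · rw [← sum_drawProb (G := G) (r := r) (v := v) (y := y) hφ S hT]
    exact Finset.single_le_sum (fun b _ => drawProb_nonneg hr hy hφ S T b) (Finset.mem_univ a)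

theorem rejected_drawProb_mem (hr : IsRegular r) (hy : IsTieFlow G r ρ v y) (hφ : IsFallback φ)
    (q : Fin A → ℝ) (S T : Finset (Fin (A + 1))) (a : Fin (A + 1)) :
    (1 - sStar r (maxAdjusted v q)) * drawProb G r v y φ S T a ∈ Set.Icc (0 : ℝ) 1 := by
  have hs := hr.sStar_mem (maxAdjusted v q)
  have h0 := drawProb_nonneg hr hy hφ S T a
  have h1 := drawProb_le_one hr hy hφ S T a
  exact ⟨mul_nonneg (by linarith [hs.2]) h0,
    mul_le_one₀ (by linarith [hs.1]) h0 h1⟩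

theorem measurable_rejected_drawProb (hr : IsRegular r) (v : Fin A → ℝ) (a : Fin (A + 1)) :
    Measurable fun q => (1 - sStar r (maxAdjusted v q)) *
      drawProb G r v y φ (argmaxIn v q Finset.univ) (argmaxIn v q Finset.univ) a :=
  ((hr.measurable_sStar_maxAdjusted v).const_sub 1).mul
    (measurable_comp_argmaxIn v _ fun S => drawProb G r v y φ S S a)

theorem integrable_rejected_drawProb [IsProbabilityMeasure G] (hr : IsRegular r)
    (hy : IsTieFlow G r ρ v y)
    (hφ : IsFallback φ) (a : Fin (A + 1)) :
    Integrable (fun q => (1 - sStar r (maxAdjusted v q)) *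
      drawProb G r v y φ (argmaxIn v q Finset.univ) (argmaxIn v q Finset.univ) a) G :=
  .of_bound (measurable_rejected_drawProb hr v a).aestronglyMeasurable 1 (.of_forall fun q => by
    have h := rejected_drawProb_mem hr hy hφ q
      (argmaxIn v q Finset.univ) (argmaxIn v q Finset.univ) a
    rw [Real.norm_eq_abs, abs_of_nonneg h.1]
    exact h.2)

/-- The expected yield of one impression that is priced and routed according to the bid prices and
the tie-breaking flow is the dual value. -/
theorem integral_static_yield [IsProbabilityMeasure G] (hr : IsRegular r)
    (hG : ∀ a, Integrable (fun q : Fin A → ℝ => q a) G) (hy : IsTieFlow G r ρ v y)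
    (hφ : IsFallback φ) :
    ∫ q, (r (sStar r (maxAdjusted v q)) + (1 - sStar r (maxAdjusted v q)) *
      ∑ a, drawProb G r v y φ (argmaxIn v q Finset.univ) (argmaxIn v q Finset.univ) a *
        quality q a) ∂G = dual G r ρ v := by
  have h : ∀ q, r (sStar r (maxAdjusted v q)) + (1 - sStar r (maxAdjusted v q)) *
      ∑ a, drawProb G r v y φ (argmaxIn v q Finset.univ) (argmaxIn v q Finset.univ) a *
        quality q a = optGain r (maxAdjusted v q) + ∑ a : Fin A, v a *
        ((1 - sStar r (maxAdjusted v q)) * drawProb G r v y φ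
          (argmaxIn v q Finset.univ) (argmaxIn v q Finset.univ) a.succ) := fun q => by
    rw [sum_drawProb_mul_quality hφ, ← hr.gain_sStar, gain, mul_add, Finset.mul_sum, add_assoc]
    congr 2
    exact Finset.sum_congr rfl fun a _ => by ring
  simp only [h, dual]
  rw [integral_add (hr.integrable_optGain hG v) (integrable_finsetSum _ fun a _ =>
      (integrable_rejected_drawProb hr hy hφ a.succ).const_mul _),
    integral_finsetSum _ fun a _ => (integrable_rejected_drawProb hr hy hφ a.succ).const_mul _]
  simp only [integral_const_mul, integral_rejected_drawProb hr hy]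

end Routing

/-! ### Strong duality for the deterministic approximation problem -/

section Deterministic

variable {A : ℕ} {G : Measure (Fin A → ℝ)} {r : ℝ → ℝ} {ρ v : Fin A → ℝ}
  {y φ : Finset (Fin (A + 1)) → Fin (A + 1) → ℝ}

theorem IsRegular.integrable_comp (hr : IsRegular r) {α : Type*} [MeasurableSpace α]
    {μ : Measure α} [IsFiniteMeasure μ] {s : α → ℝ}
    (hs : Measurable s) (hs' : ∀ x, s x ∈ Set.Icc (0 : ℝ) 1) : Integrable (fun x => r (s x)) μ := by
  obtain ⟨M, hM⟩ := hr.bounded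
  refine .of_bound (hr.measurable_comp hs hs').aestronglyMeasurable M (.of_forall fun x => ?_)
  rw [Real.norm_eq_abs, abs_of_nonneg (hr.nonneg _ (hs' x))]
  exact hM _ (hs' x)

theorem IsControl.s_mem {s : (Fin A → ℝ) → ℝ} {i : (Fin A → ℝ) → Fin A → ℝ} (h : IsControl s i)
    (q : Fin A → ℝ) : s q ∈ Set.Icc (0 : ℝ) 1 :=
  ⟨h.s_nonneg q, by
    have := Finset.sum_nonneg fun a (_ : a ∈ Finset.univ) => h.i_nonneg q a
    linarith [h.sum_le_one q]⟩

theorem IsControl.i_le_one {s : (Fin A → ℝ) → ℝ} {i : (Fin A → ℝ) → Fin A → ℝ} (h : IsControl s i)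
    (q : Fin A → ℝ) (a : Fin A) : i q a ≤ 1 := by
  have := Finset.single_le_sum (fun a _ => h.i_nonneg q a) (Finset.mem_univ a)
  linarith [h.sum_le_one q, h.s_nonneg q]

theorem IsControl.abs_i_le_one {s : (Fin A → ℝ) → ℝ} {i : (Fin A → ℝ) → Fin A → ℝ}
    (h : IsControl s i) (q : Fin A → ℝ) (a : Fin A) : ‖i q a‖ ≤ 1 := by
  rw [Real.norm_eq_abs, abs_of_nonneg (h.i_nonneg q a)]
  exact h.i_le_one q a

theorem IsControl.measurable_i_apply {s : (Fin A → ℝ) → ℝ} {i : (Fin A → ℝ) → Fin A → ℝ}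
    (h : IsControl s i) (a : Fin A) : Measurable fun q => i q a :=
  (measurable_pi_apply a).comp h.measurable_i

/-- Lagrangian relaxation of the capacity constraints, pointwise in q. Unassigned mass can be given
to option 0, since the adjusted maximum is non-negative, and the rest is the definition of R. -/
theorem IsControl.integral_le [IsProbabilityMeasure G] (hr : IsRegular r)
    (hG : ∀ a, Integrable (fun q : Fin A → ℝ => q a) G) (v : Fin A → ℝ)
    {s : (Fin A → ℝ) → ℝ} {i : (Fin A → ℝ) → Fin A → ℝ} (h : IsControl s i) :
    ∫ q, (r (s q) + ∑ a, i q a * q a) ∂G ≤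
      ∫ q, optGain r (maxAdjusted v q) ∂G + ∑ a, v a * ∫ q, i q a ∂G := by
  have hi : ∀ a, Integrable (fun q => i q a) G := fun a =>
    .of_bound (h.measurable_i_apply a).aestronglyMeasurable 1 (.of_forall fun q =>
      h.abs_i_le_one q a)
  have hiq : ∀ a, Integrable (fun q => i q a * q a) G := fun a =>
    (hG a).bdd_mul (h.measurable_i_apply a).aestronglyMeasurable (.of_forall fun q =>
      h.abs_i_le_one q a)
  simp only [← integral_const_mul]
  rw [← integral_finsetSum _ fun a _ => (hi a).const_mul _,
    ← integral_add (hr.integrable_optGain hG v)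
      (integrable_finsetSum _ fun a _ => (hi a).const_mul _)]
  refine integral_mono ((hr.integrable_comp h.measurable_s h.s_mem).add
    (integrable_finsetSum _ fun a _ => hiq a))
    ((hr.integrable_optGain hG v).add (integrable_finsetSum _ fun a _ => (hi a).const_mul _))
    fun q => ?_
  have h1 : ∑ a, i q a * q a ≤ (1 - s q) * maxAdjusted v q + ∑ a, v a * i q a := by
    have h2 : ∑ a, i q a * q a ≤ ∑ a, (i q a * maxAdjusted v q + v a * i q a) :=
      Finset.sum_le_sum fun a _ => by
        have := adjusted_le_maxAdjusted v q a.succ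
        rw [adjusted_succ] at this
        nlinarith [h.i_nonneg q a]
    rw [Finset.sum_add_distrib, ← Finset.sum_mul] at h2
    have h3 : (∑ a, i q a) * maxAdjusted v q ≤ (1 - s q) * maxAdjusted v q :=
      mul_le_mul_of_nonneg_right (by linarith [h.sum_le_one q]) (maxAdjusted_nonneg v q)
    linarith
  have h4 := hr.gain_le_optGain (maxAdjusted v q) (h.s_mem q)
  simp only [gain] at h4
  show r (s q) + ∑ a, i q a * q a ≤ optGain r (maxAdjusted v q) + ∑ a, v a * i q a
  linarith

theorem le_of_mem_dapValues [IsProbabilityMeasure G] (hr : IsRegular r)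
    (hG : ∀ a, Integrable (fun q : Fin A → ℝ => q a) G) (v : Fin A → ℝ) {N : ℕ} {z : ℝ}
    (hz : z ∈ dapValues G r ρ N) : z ≤ N * dual G r ρ v := by
  obtain ⟨s, i, hc, hcap, rfl⟩ := hz
  refine (Finset.sum_le_sum fun n _ => (hc n).integral_le hr hG v).trans_eq ?_
  rw [Finset.sum_add_distrib, Finset.sum_comm]
  simp only [← Finset.mul_sum, hcap, dual, mul_add, Finset.sum_const, Finset.card_univ,
    Fintype.card_fin, nsmul_eq_mul]
  congr 1
  rw [Finset.mul_sum]
  exact Finset.sum_congr rfl fun a _ => by ring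

theorem isControl_static (hr : IsRegular r) (hy : IsTieFlow G r ρ v y) (hφ : IsFallback φ) :
    IsControl (fun q => sStar r (maxAdjusted v q))
      (fun q a => (1 - sStar r (maxAdjusted v q)) *
        drawProb G r v y φ (argmaxIn v q Finset.univ) (argmaxIn v q Finset.univ) a.succ) where
  measurable_s := hr.measurable_sStar_maxAdjusted v
  measurable_i := measurable_pi_iff.2 fun a => measurable_rejected_drawProb hr v a.succ
  s_nonneg q := (hr.sStar_mem _).1
  i_nonneg q a := (rejected_drawProb_mem hr hy hφ q _ _ _).1
  sum_le_one q := by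
    set S := argmaxIn v q Finset.univ
    have h1 := sum_drawProb (G := G) (r := r) (v := v) (y := y) hφ S
      (argmaxIn_nonempty v q Finset.univ_nonempty)
    rw [Fin.sum_univ_succ] at h1
    have h0 := drawProb_nonneg hr hy hφ S S 0
    have hs := (hr.sStar_mem (maxAdjusted v q)).2
    rw [← Finset.mul_sum]
    nlinarith

theorem mul_dual_mem_dapValues [IsProbabilityMeasure G] (hr : IsRegular r)
    (hG : ∀ a, Integrable (fun q : Fin A → ℝ => q a) G) (hy : IsTieFlow G r ρ v y)
    (hφ : IsFallback φ) (N : ℕ) : N * dual G r ρ v ∈ dapValues G r ρ N := by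
  refine ⟨fun _ => _, fun _ => _, fun _ => isControl_static hr hy hφ, fun a => ?_, ?_⟩
  · simp [integral_rejected_drawProb hr hy]
  · simp only [Finset.sum_const, Finset.card_univ, Fintype.card_fin, nsmul_eq_mul]
    rw [← integral_static_yield hr hG hy hφ]
    simp [Fin.sum_univ_succ, Finset.mul_sum, mul_assoc]

/-- The flow makes the static control feasible with the value of the upper bound, so the supremum is
attained and is exactly linear in N. -/
theorem JD_eq [IsProbabilityMeasure G] (hr : IsRegular r)
    (hG : ∀ a, Integrable (fun q : Fin A → ℝ => q a) G)
    (hy : IsTieFlow G r ρ v y) (hφ : IsFallback φ) (N : ℕ) :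
    JD G r ρ N = N * dual G r ρ v :=
  IsGreatest.csSup_eq ⟨mul_dual_mem_dapValues hr hG hy hφ N,
    fun _ hz => le_of_mem_dapValues hr hG v hz⟩

end Deterministic

end AdX

noncomputable section

namespace AdX

/-! ### The law of the impressions -/

section PathLaw

open ProbabilityTheory

variable {A : ℕ} (G : Measure (Fin A → ℝ)) [IsProbabilityMeasure G]

/-- The law of one impression. -/
abbrev impressionLaw : Measure (Impression A) :=
  G.prod ((volume : Measure unitInterval).prod volume)

/-- The first `n` impressions. -/
def past (n : ℕ) (ω : ℕ → Impression A) : Fin n → Impression A := fun i => ω i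

instance : IsProbabilityMeasure (pathLaw G) := by
  unfold pathLaw; infer_instance

@[fun_prop]
theorem measurable_past (n : ℕ) : Measurable (past (A := A) n) := by
  unfold past; fun_prop

theorem map_eval_pathLaw (n : ℕ) : (pathLaw G).map (fun ω => ω n) = impressionLaw G :=
  Measure.infinitePi_map_eval _ n

theorem indepFun_past (n : ℕ) :
    IndepFun (past (A := A) n) (fun ω => ω n) (pathLaw G) := by
  have h := (iIndepFun_infinitePi (P := fun _ : ℕ => impressionLaw G)
    (X := fun _ z => z) (fun _ => measurable_id)).indepFun_finset (Finset.range n) {n}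
    (by simp) (fun i => measurable_pi_apply i)
  have h1 : Measurable fun (z : Finset.range n → Impression A) (i : Fin n) =>
      z ⟨i, Finset.mem_range.2 i.2⟩ := by fun_prop
  have h2 : Measurable fun z : ({n} : Finset ℕ) → Impression A =>
      z ⟨n, Finset.mem_singleton_self n⟩ := measurable_pi_apply _
  exact h.comp h1 h2

/-- The present impression is independent of the past. This product form replaces conditional
expectations: they become inner integrals over one impression. -/
theorem map_past_eval (n : ℕ) :
    (pathLaw G).map (fun ω => (past n ω, ω n)) =
      ((pathLaw G).map (past n)).prod (impressionLaw G) := by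
  rw [(indepFun_past G n).map_prod_eq_prod_map_map (measurable_past n).aemeasurable
    (measurable_pi_apply n).aemeasurable, map_eval_pathLaw]

instance (n : ℕ) : IsProbabilityMeasure ((pathLaw G).map (past n)) :=
  Measure.isProbabilityMeasure_map (measurable_past n).aemeasurable

variable {G}

/-- The envelope depends on the present impression alone, so it is uniform over histories; qualities
need only be integrable. -/
theorem integrable_past_prod {n : ℕ} {F : (Fin n → Impression A) × Impression A → ℝ}
    (hF : Measurable F) {b : Impression A → ℝ} (hb : Integrable b (impressionLaw G))
    (hFb : ∀ h z, |F (h, z)| ≤ b z) :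
    Integrable F (((pathLaw G).map (past n)).prod (impressionLaw G)) :=
  (hb.comp_snd _).mono' hF.aestronglyMeasurable (.of_forall fun z => hFb z.1 z.2)

theorem integrable_pathLaw {n : ℕ} {F : (Fin n → Impression A) × Impression A → ℝ}
    (hF : Measurable F) {b : Impression A → ℝ} (hb : Integrable b (impressionLaw G))
    (hFb : ∀ h z, |F (h, z)| ≤ b z) :
    Integrable (fun ω => F (past n ω, ω n)) (pathLaw G) := by
  have h := integrable_past_prod hF hb hFb
  rw [← map_past_eval] at h
  exact h.comp_measurable (by fun_prop)

/-- Expectations are computed by first averaging over the present impression. -/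
theorem integral_pathLaw {n : ℕ} {F : (Fin n → Impression A) × Impression A → ℝ}
    (hF : Measurable F) {b : Impression A → ℝ} (hb : Integrable b (impressionLaw G))
    (hFb : ∀ h z, |F (h, z)| ≤ b z) :
    ∫ ω, F (past n ω, ω n) ∂pathLaw G =
      ∫ ω, ∫ z, F (past n ω, z) ∂impressionLaw G ∂pathLaw G := by
  have h := integrable_past_prod hF hb hFb
  rw [← integral_map (φ := fun ω => (past n ω, ω n)) (by fun_prop) hF.aestronglyMeasurable,
    map_past_eval, integral_prod _ h,
    integral_map (measurable_past n).aemeasurable h.aestronglyMeasurable.integral_prod_right']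

theorem integral_eval_quality (n : ℕ) {f : (Fin A → ℝ) → ℝ} (hf : AEStronglyMeasurable f G) :
    ∫ ω, f (ω n).1 ∂pathLaw G = ∫ q, f q ∂G := by
  have hm : Measurable fun ω : ℕ → Impression A => (ω n).1 :=
    measurable_fst.comp (measurable_pi_apply n)
  have h1 : (pathLaw G).map (fun ω => (ω n).1) = G := by
    have : (fun ω : ℕ → Impression A => (ω n).1) = Prod.fst ∘ fun ω => ω n := rfl
    rw [this, ← Measure.map_map measurable_fst (measurable_pi_apply n), map_eval_pathLaw]
    exact measurePreserving_fst.map_eq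
  conv_rhs => rw [← h1]
  rw [integral_map hm.aemeasurable (by rwa [h1])]

theorem integrable_fst_impressionLaw {H : Measure (Fin A → ℝ)} {f : (Fin A → ℝ) → ℝ}
    (hf : Integrable f H) : Integrable (fun z => f z.1) (impressionLaw H) :=
  hf.comp_fst _

theorem integrable_eval_quality (n : ℕ) {f : (Fin A → ℝ) → ℝ} (hf : Integrable f G) :
    Integrable (fun ω => f (ω n).1) (pathLaw G) := by
  have h := integrable_fst_impressionLaw hf
  rw [← map_eval_pathLaw G n] at h
  exact h.comp_measurable (measurable_pi_apply n)

theorem ae_pathLaw_of_ae (n : ℕ) {P : Impression A → Prop} (h : ∀ᵐ z ∂impressionLaw G, P z) :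
    ∀ᵐ ω ∂pathLaw G, P (ω n) := by
  rw [← map_eval_pathLaw G n] at h
  exact ae_of_ae_map (measurable_pi_apply n).aemeasurable h

theorem ae_pathLaw_quality_nonneg (hG_nonneg : ∀ᵐ q ∂G, ∀ a, 0 ≤ q a) :
    ∀ᵐ ω ∂pathLaw G, ∀ n a, 0 ≤ (ω n).1 a :=
  ae_all_iff.2 fun n => ae_pathLaw_of_ae n
    (P := fun z => ∀ a, 0 ≤ z.1 a) (Measure.quasiMeasurePreserving_fst.ae hG_nonneg)

theorem ae_pathLaw_lt_one : ∀ᵐ ω ∂pathLaw G, ∀ n, ((ω n).2.2 : ℝ) < 1 :=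
  ae_all_iff.2 fun n => ae_pathLaw_of_ae n (P := fun z => (z.2.2 : ℝ) < 1)
    (Measure.quasiMeasurePreserving_snd.ae (Measure.quasiMeasurePreserving_snd.ae ae_lt_one))

theorem integral_rejected {s : ℝ} (hs : s ∈ Set.Icc (0 : ℝ) 1) :
    ∫ u : unitInterval, (if (u : ℝ) < s then (0 : ℝ) else 1) = 1 - s := by
  have h : ∀ u : unitInterval, (if (u : ℝ) < s then (0 : ℝ) else 1) =
      (Set.Ici (⟨s, hs⟩ : unitInterval)).indicator 1 u := fun u => by
    rw [Set.indicator_apply]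
    by_cases hu : (u : ℝ) < s
    · rw [if_pos hu, if_neg (by simpa [← Subtype.coe_le_coe] using hu)]
    · rw [if_neg hu, if_pos (by simpa [← Subtype.coe_le_coe] using hu)]; rfl
  simp only [h]
  rw [integral_indicator_one measurableSet_Ici, measureReal_def, unitInterval.volume_Ici]
  simp [hs.2]

section OneImpression

variable {s : (Fin A → ℝ) → ℝ} {k : (Fin A → ℝ) × unitInterval → ℝ} {b : (Fin A → ℝ) → ℝ}

theorem integral_weighted (hs : Measurable s) (hs' : ∀ q, s q ∈ Set.Icc (0 : ℝ) 1)
    (hk : Measurable k) (hb : Integrable b G) (hkb : ∀ q w, |k (q, w)| ≤ b q) :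
    ∫ z, (1 - s z.1) * k (z.1, z.2.2) ∂impressionLaw G =
      ∫ q, ((1 - s q) * ∫ w, k (q, w)) ∂G := by
  rw [integral_prod]
  · refine integral_congr_ae (.of_forall fun q => ?_)
    have := integral_prod_mul (μ := (volume : Measure unitInterval))
      (ν := (volume : Measure unitInterval)) (fun _ => 1 - s q) (fun w => k (q, w))
    simpa using this
  · refine (integrable_fst_impressionLaw hb).mono' (by fun_prop) (.of_forall fun z => ?_)
    have h := hs' z.1
    rw [Real.norm_eq_abs, abs_mul, abs_of_nonneg (by linarith [h.2])]
    exact (mul_le_of_le_one_left (abs_nonneg _) (by linarith [h.1])).trans (hkb _ _)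

theorem integral_if_rejected (hs : Measurable s) (hs' : ∀ q, s q ∈ Set.Icc (0 : ℝ) 1)
    (hk : Measurable k) (hb : Integrable b G) (hkb : ∀ q w, |k (q, w)| ≤ b q) :
    ∫ z, (if (z.2.1 : ℝ) < s z.1 then 0 else k (z.1, z.2.2)) ∂impressionLaw G =
      ∫ q, ((1 - s q) * ∫ w, k (q, w)) ∂G := by
  rw [integral_prod]
  · refine integral_congr_ae (.of_forall fun q => ?_)
    have := integral_prod_mul (μ := (volume : Measure unitInterval))
      (ν := (volume : Measure unitInterval))
      (fun u => if (u : ℝ) < s q then 0 else 1) (fun w => k (q, w))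
    rw [integral_rejected (hs' q)] at this
    simpa using this
  · refine (integrable_fst_impressionLaw hb).mono'
      (Measurable.ite (measurableSet_lt (by fun_prop) (by fun_prop)) measurable_const
        (by fun_prop)).aestronglyMeasurable (.of_forall fun z => ?_)
    rw [Real.norm_eq_abs]
    split_ifs
    · simpa using (abs_nonneg _).trans (hkb z.1 z.2.2)
    · exact hkb _ _

end OneImpression

end PathLaw

/-! ### Weak duality for policies -/

section WeakDuality

variable {A : ℕ} {G : Measure (Fin A → ℝ)} [IsProbabilityMeasure G] {r : ℝ → ℝ} {ρ : Fin A → ℝ}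
  {μ : Policy A} {N : ℕ} {C : Fin A → ℕ}

/-- The yield of one impression. -/
def Policy.stepYield (μ : Policy A) (r : ℝ → ℝ) (n : ℕ)
    (x : (Fin n → Impression A) × Impression A) : ℝ :=
  r (μ.accept n x.1 x.2.1) +
    (1 - μ.accept n x.1 x.2.1) * quality x.2.1 (μ.target n x.1 x.2.1 x.2.2.2)

theorem Policy.IsAdmissible.measurable_s (hμ : μ.IsAdmissible G N C) (n : ℕ) :
    Measurable fun x : (Fin n → Impression A) × Impression A => μ.accept n x.1 x.2.1 :=
  (hμ.measurable_accept n).comp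
    (g := fun z : (Fin n → Impression A) × (Fin A → ℝ) => μ.accept n z.1 z.2)
    (f := fun x : (Fin n → Impression A) × Impression A => (x.1, x.2.1)) (by fun_prop)

theorem Policy.IsAdmissible.measurable_choice (hμ : μ.IsAdmissible G N C) (n : ℕ) :
    Measurable fun x : (Fin n → Impression A) × Impression A =>
      μ.target n x.1 x.2.1 x.2.2.2 :=
  (hμ.measurable_target n).comp
    (g := fun z : (Fin n → Impression A) × (Fin A → ℝ) × unitInterval => μ.target n z.1 z.2.1 z.2.2)
    (f := fun x : (Fin n → Impression A) × Impression A => (x.1, x.2.1, x.2.2.2)) (by fun_prop)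

theorem measurable_quality_uncurry {α : Type*} [MeasurableSpace α] {f : α → Fin A → ℝ}
    {g : α → Fin (A + 1)} (hf : Measurable f) (hg : Measurable g) :
    Measurable fun x => quality (f x) (g x) := by
  have h : Measurable fun z : (Fin A → ℝ) × Fin (A + 1) => quality z.1 z.2 :=
    measurable_from_prod_countable_left fun a => measurable_quality a
  exact h.comp (hf.prodMk hg)

theorem Policy.IsAdmissible.measurable_stepYield (hr : IsRegular r) (hμ : μ.IsAdmissible G N C)
    (n : ℕ) : Measurable (μ.stepYield r n) :=
  (hr.measurable_comp (hμ.measurable_s n) fun _ => hμ.accept_mem n _ _).add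
    (((hμ.measurable_s n).const_sub 1).mul
      (measurable_quality_uncurry (by fun_prop) (hμ.measurable_choice n)))

theorem Policy.IsAdmissible.abs_stepYield_le (hr : IsRegular r) (hμ : μ.IsAdmissible G N C)
    {M : ℝ} (hM : ∀ s ∈ Set.Icc (0 : ℝ) 1, r s ≤ M) (n : ℕ) (h : Fin n → Impression A)
    (z : Impression A) : |μ.stepYield r n (h, z)| ≤ M + ∑ b, |z.1 b| := by
  have hs := hμ.accept_mem n h z.1
  refine (abs_add_le _ _).trans (add_le_add ?_ ?_)
  · rw [abs_of_nonneg (hr.nonneg _ hs)]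
    exact hM _ hs
  · rw [abs_mul, abs_of_nonneg (by linarith [hs.2])]
    exact (mul_le_of_le_one_left (abs_nonneg _) (by linarith [hs.1])).trans (abs_quality_le _ _)

theorem Policy.yield_eq (μ : Policy A) :
    μ.yield G r N = ∫ ω, ∑ n ∈ Finset.range N, μ.stepYield r n (past n ω, ω n) ∂pathLaw G := rfl

theorem integrable_stepBound (hG : ∀ a, Integrable (fun q : Fin A → ℝ => q a) G) (M : ℝ) :
    Integrable (fun z : Impression A => M + ∑ b, |z.1 b|) (impressionLaw G) :=
  integrable_fst_impressionLaw (f := fun q => M + ∑ b, |q b|)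
    ((integrable_const M).add (integrable_sum_abs hG))

theorem Policy.IsAdmissible.integrable_stepYield (hr : IsRegular r) (hμ : μ.IsAdmissible G N C)
    (hG : ∀ a, Integrable (fun q : Fin A → ℝ => q a) G) (n : ℕ) :
    Integrable (fun ω => μ.stepYield r n (past n ω, ω n)) (pathLaw G) := by
  obtain ⟨M, hM⟩ := hr.bounded
  exact integrable_pathLaw (hμ.measurable_stepYield hr n) (integrable_stepBound hG M)
    (hμ.abs_stepYield_le hr hM n)

open Classical in
-- A pathwise count: option 0 has price zero, so the prices of rejected impressions add up to the
-- contracts served.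
theorem Policy.sum_rejected_quality (μ : Policy A) (v : Fin A → ℝ) (ω : ℕ → Impression A) :
    ∑ n ∈ Finset.range N, (if ((ω n).2.1 : ℝ) < μ.s n ω then 0 else quality v (μ.choice n ω)) =
      ∑ a, v a * μ.assigned N a ω := by
  have h : ∀ a, (μ.assigned N a ω : ℝ) = ∑ n ∈ Finset.range N,
      if ¬ μ.Accepted n ω ∧ μ.choice n ω = a.succ then 1 else 0 := fun a => by
    rw [Policy.assigned, Finset.sum_boole]
  simp only [h, Finset.mul_sum]
  rw [Finset.sum_comm]
  refine Finset.sum_congr rfl fun n _ => ?_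
  change (if μ.Accepted n ω then 0 else _) = _
  by_cases hacc : μ.Accepted n ω
  · simp [hacc]
  · simp only [hacc, if_false, not_false_eq_true, true_and]
    refine Fin.cases (motive := fun c => quality v c = ∑ a, v a * if c = a.succ then 1 else 0)
      ?_ (fun b => ?_) (μ.choice n ω)
    · simp [(Fin.succ_ne_zero _).symm]
    · simp

/-- The yield carries the weight 1 - s while the contracts count actual rejections. They agree in
mean because the uniform variable deciding acceptance is independent of the past, the qualities and
the variable used for the choice. -/
theorem Policy.IsAdmissible.integral_weighted_quality (hμ : μ.IsAdmissible G N C) (v : Fin A → ℝ)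
    (n : ℕ) :
    ∫ ω, (1 - μ.s n ω) * quality v (μ.choice n ω) ∂pathLaw G =
      ∫ ω, (if ((ω n).2.1 : ℝ) < μ.s n ω then 0 else quality v (μ.choice n ω)) ∂pathLaw G := by
  have hqv : Measurable fun x : (Fin n → Impression A) × Impression A =>
      quality v (μ.target n x.1 x.2.1 x.2.2.2) :=
    measurable_quality_uncurry measurable_const (hμ.measurable_choice n)
  have hconst : Integrable (fun _ : Impression A => ∑ b, |v b|) (impressionLaw G) :=
    integrable_const _
  have hs := fun h q => hμ.accept_mem n h q
  refine (integral_pathLaw (F := fun x => (1 - μ.accept n x.1 x.2.1) *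
      quality v (μ.target n x.1 x.2.1 x.2.2.2)) (((hμ.measurable_s n).const_sub 1).mul hqv)
      hconst fun h z => ?_).trans
    (Eq.trans ?_ (integral_pathLaw (F := fun x => if (x.2.2.1 : ℝ) < μ.accept n x.1 x.2.1 then 0
      else quality v (μ.target n x.1 x.2.1 x.2.2.2)) (Measurable.ite (measurableSet_lt
        (by fun_prop) (hμ.measurable_s n)) measurable_const hqv) hconst fun h z => ?_).symm)
  · rw [abs_mul, abs_of_nonneg (by linarith [(hs h z.1).2])]
    exact (mul_le_of_le_one_left (abs_nonneg _) (by linarith [(hs h z.1).1])).trans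
      (abs_quality_le _ _)
  · refine integral_congr_ae (.of_forall fun ω => ?_)
    have h1 : Measurable (μ.accept n (past n ω)) :=
      (hμ.measurable_accept n).comp (f := fun q => (past n ω, q)) (by fun_prop)
    have h2 : Measurable fun x : (Fin A → ℝ) × unitInterval =>
        quality v (μ.target n (past n ω) x.1 x.2) :=
      measurable_quality_uncurry measurable_const
        ((hμ.measurable_target n).comp (f := fun x => (past n ω, x)) (by fun_prop))
    exact (integral_weighted h1 (hs _) h2 (integrable_const (∑ b, |v b|))
      fun q w => abs_quality_le _ _).trans (integral_if_rejected h1 (hs _) h2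
        (integrable_const (∑ b, |v b|)) fun q w => abs_quality_le _ _).symm
  · split_ifs
    · simpa using Finset.sum_nonneg fun b _ => abs_nonneg (v b)
    · exact abs_quality_le _ _

theorem Policy.IsAdmissible.measurable_s_path (hμ : μ.IsAdmissible G N C) (n : ℕ) :
    Measurable (μ.s n) :=
  (hμ.measurable_s n).comp (f := fun ω => (past n ω, ω n)) (by fun_prop)

theorem Policy.IsAdmissible.measurable_choice_path (hμ : μ.IsAdmissible G N C) (n : ℕ) :
    Measurable (μ.choice n) :=
  (hμ.measurable_choice n).comp (f := fun ω => (past n ω, ω n)) (by fun_prop)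

/-- The dual bounds the yield of every admissible policy. -/
theorem Policy.IsAdmissible.yield_le (hr : IsRegular r) (hμ : μ.IsAdmissible G N C)
    (hG : ∀ a, Integrable (fun q : Fin A → ℝ => q a) G) (hC : ∀ a, (C a : ℝ) = N * ρ a)
    (v : Fin A → ℝ) : μ.yield G r N ≤ N * dual G r ρ v := by
  have hqv : ∀ n, Measurable fun ω => quality v (μ.choice n ω) := fun n =>
    measurable_quality_uncurry measurable_const (hμ.measurable_choice_path n)
  have hint1 : ∀ n, Integrable (fun ω => (1 - μ.s n ω) * quality v (μ.choice n ω)) (pathLaw G) :=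
    fun n => .of_bound (((hμ.measurable_s_path n).const_sub 1).mul (hqv n)).aestronglyMeasurable
      (∑ b, |v b|) (.of_forall fun ω => by
        have hs := hμ.accept_mem n (fun i => ω i) (ω n).1
        change μ.s n ω ∈ _ at hs
        rw [Real.norm_eq_abs, abs_mul, abs_of_nonneg (by linarith [hs.2])]
        exact (mul_le_of_le_one_left (abs_nonneg _) (by linarith [hs.1])).trans
          (abs_quality_le _ _))
  have hint2 : ∀ n, Integrable (fun ω => if ((ω n).2.1 : ℝ) < μ.s n ω then 0
      else quality v (μ.choice n ω)) (pathLaw G) :=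
    fun n => .of_bound (Measurable.ite (measurableSet_lt (by fun_prop) (hμ.measurable_s_path n))
      measurable_const (hqv n)).aestronglyMeasurable
      (∑ b, |v b|) (.of_forall fun ω => by
        split_ifs
        · simpa using Finset.sum_nonneg fun b _ => abs_nonneg (v b)
        · exact abs_quality_le _ _)
  have hstep : ∀ n, ∫ ω, μ.stepYield r n (past n ω, ω n) ∂pathLaw G ≤
      ∫ q, optGain r (maxAdjusted v q) ∂G +
        ∫ ω, (if ((ω n).2.1 : ℝ) < μ.s n ω then 0 else quality v (μ.choice n ω)) ∂pathLaw G := by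
    intro n
    rw [← hμ.integral_weighted_quality, ← integral_eval_quality n
      (hr.integrable_optGain hG v).aestronglyMeasurable,
      ← integral_add (integrable_eval_quality n (hr.integrable_optGain hG v)) (hint1 n)]
    refine integral_mono (hμ.integrable_stepYield hr hG n)
      ((integrable_eval_quality n (hr.integrable_optGain hG v)).add (hint1 n)) fun ω => ?_
    have hs := hμ.accept_mem n (fun i => ω i) (ω n).1
    change μ.s n ω ∈ _ at hs
    have h1 := hr.gain_le_optGain (maxAdjusted v (ω n).1) hs
    have h2 := adjusted_le_maxAdjusted v (ω n).1 (μ.choice n ω)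
    simp only [gain, adjusted] at h1 h2
    change r (μ.s n ω) + (1 - μ.s n ω) * quality (ω n).1 (μ.choice n ω) ≤
      optGain r (maxAdjusted v (ω n).1) + (1 - μ.s n ω) * quality v (μ.choice n ω)
    nlinarith [hs.2]
  rw [Policy.yield_eq, integral_finsetSum _ fun n _ => hμ.integrable_stepYield hr hG n]
  refine (Finset.sum_le_sum fun n _ => hstep n).trans_eq ?_
  rw [Finset.sum_add_distrib, ← integral_finsetSum _ fun n _ => hint2 n]
  -- The contracts hold almost surely, so the total of the prices is a constant and no sign of v is
  -- needed.
  have hcontracts : ∫ ω, ∑ n ∈ Finset.range N,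
      (if ((ω n).2.1 : ℝ) < μ.s n ω then 0 else quality v (μ.choice n ω)) ∂pathLaw G =
        ∫ _, ∑ a, v a * (N * ρ a) ∂pathLaw G := by
    refine integral_congr_ae ?_
    filter_upwards [hμ.contracts] with ω hω
    rw [μ.sum_rejected_quality v ω]
    simp [hω, hC]
  rw [hcontracts]
  simp only [integral_const, probReal_univ, one_smul, Finset.sum_const, Finset.card_range,
    nsmul_eq_mul, dual, mul_add, Finset.mul_sum]
  congr 1
  exact Finset.sum_congr rfl fun a _ => by ring

end WeakDuality

end AdX

end

noncomputable section

namespace AdX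

/-! ### Admissibility of the static bid-price policy -/

section Admissible

variable {A : ℕ} {G : Measure (Fin A → ℝ)} {r : ℝ → ℝ} {ρ v : Fin A → ℝ}
  {y φ : Finset (Fin (A + 1)) → Fin (A + 1) → ℝ} {N : ℕ} {C : Fin A → ℕ}

theorem measurable_bidAccept (hr : IsRegular r) (v : Fin A → ℝ) (m : ℕ) :
    Measurable fun z : (Fin A → ℕ) × (Fin A → ℝ) => bidAccept r v m z.1 z.2 := by
  refine measurable_from_prod_countable_right fun x => ?_
  by_cases h : ∑ a, x a < m
  · simp only [bidAccept, h, if_true]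
    exact hr.measurable_sStar.comp
      (measurable_sup'_adjusted v (insert 0 (active x)) (Finset.insert_nonempty _ _))
  · simp only [bidAccept, h, if_false, measurable_const]

/-- Drawing from a vector that depends measurably on the data through finitely many cases. -/
theorem measurable_draw_comp {α β : Type*} [MeasurableSpace α] [Countable β] [MeasurableSpace β]
    [DiscreteMeasurableSpace β] (p : β → Fin (A + 1) → ℝ) {f : α → β} (hf : Measurable f) :
    Measurable fun z : α × unitInterval => draw (p (f z.1)) z.2 := by
  have h : Measurable fun z : β × unitInterval => draw (p z.1) z.2 :=
    measurable_from_prod_countable_right fun b => measurable_draw (p b)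
  exact h.comp (f := fun z : α × unitInterval => (f z.1, z.2))
    ((hf.comp measurable_fst).prodMk measurable_snd)

theorem measurable_bidTarget (m : ℕ) :
    Measurable fun z : (Fin A → ℕ) × (Fin A → ℝ) × unitInterval =>
      bidTarget G r v y φ m z.1 z.2.1 z.2.2 := by
  refine measurable_from_prod_countable_right fun x => ?_
  let _ : MeasurableSpace (Finset (Fin (A + 1))) := ⊤
  have : DiscreteMeasurableSpace (Finset (Fin (A + 1))) := ⟨fun _ => trivial⟩
  have hST : Measurable fun q : Fin A → ℝ =>
      (argmaxIn v q Finset.univ, argmaxIn v q (eligible m x)) :=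
    (measurable_comp_argmaxIn v Finset.univ fun S => S).prodMk
      (measurable_comp_argmaxIn v (eligible m x) fun S => S)
  have h := measurable_draw_comp (fun b : Finset (Fin (A + 1)) × Finset (Fin (A + 1)) =>
    drawProb G r v y φ b.1 b.2) hST
  simpa only [bidTarget] using h

theorem measurable_remaining (hr : IsRegular r) (n : ℕ) :
    Measurable (remaining G r v y φ N C n) := by
  induction n with
  | zero => exact measurable_const
  | succ n ih =>
    have hx : Measurable fun h : Fin (n + 1) → Impression A =>
        remaining G r v y φ N C n (Fin.init h) :=
      ih.comp (measurable_pi_lambda _ fun i => measurable_pi_apply _)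
    have hz : Measurable fun h : Fin (n + 1) → Impression A => h (Fin.last n) :=
      measurable_pi_apply _
    refine measurable_pi_lambda _ fun a => Measurable.ite ?_ ?_ ?_
    · refine MeasurableSet.inter (MeasurableSet.compl (measurableSet_lt hz.snd.fst.subtype_val ?_)) ?_
      · exact (measurable_bidAccept hr v (N - n)).comp (hx.prodMk hz.fst)
      · exact ((measurable_bidTarget (N - n)).comp (hx.prodMk (hz.fst.prodMk hz.snd.snd)))
          (measurableSet_singleton a.succ)
    · exact (measurable_from_top (f := fun k : ℕ => k - 1)).comp ((measurable_pi_apply a).comp hx)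
    · exact (measurable_pi_apply a).comp hx

open Classical in
theorem remaining_succ (n : ℕ) (ω : ℕ → Impression A) (a : Fin A) :
    remaining G r v y φ N C (n + 1) (past (n + 1) ω) a =
      if ¬ (bidPricePolicy G r v y φ N C).Accepted n ω ∧
        (bidPricePolicy G r v y φ N C).choice n ω = a.succ
      then remaining G r v y φ N C n (past n ω) a - 1
      else remaining G r v y φ N C n (past n ω) a := by
  rw [remaining]
  exact if_congr Iff.rfl rfl rfl

theorem mem_active {x : Fin A → ℕ} {a : Fin A} : a.succ ∈ active x ↔ 0 < x a := by
  simp [active]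

theorem pos_of_mem_eligible {m : ℕ} {x : Fin A → ℕ} {a : Fin A} (h : a.succ ∈ eligible m x) :
    0 < x a := by
  rw [eligible] at h
  split_ifs at h
  · exact mem_active.1 ((Finset.mem_insert.1 h).resolve_left (Fin.succ_ne_zero a))
  · exact mem_active.1 h

theorem eligible_nonempty {m : ℕ} (hm : 0 < m) (x : Fin A → ℕ) : (eligible m x).Nonempty := by
  rw [eligible]
  split_ifs with h
  · exact Finset.insert_nonempty _ _
  · obtain ⟨a, -, ha⟩ := Finset.exists_ne_zero_of_sum_ne_zero
      (show ∑ a, x a ≠ 0 by omega)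
    exact ⟨a.succ, mem_active.2 (Nat.pos_of_ne_zero ha)⟩

theorem bidTarget_mem_eligible (hr : IsRegular r) (hy : IsTieFlow G r ρ v y) (hφ : IsFallback φ)
    {m : ℕ} (hm : 0 < m) (x : Fin A → ℕ) (q : Fin A → ℝ) {w : unitInterval} (hw : (w : ℝ) < 1) :
    bidTarget G r v y φ m x q w ∈ eligible m x := by
  have h := draw_pos (drawProb_nonneg hr hy hφ (argmaxIn v q Finset.univ)
      (argmaxIn v q (eligible m x)))
    (sum_drawProb hφ _ (argmaxIn_nonempty v q (eligible_nonempty hm x))) hw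
  by_contra hnot
  exact h.ne' (drawProb_of_notMem fun hmem => hnot (argmaxIn_subset v q _ hmem))

open Classical in
theorem Policy.assigned_succ (μ : Policy A) (n : ℕ) (a : Fin A) (ω : ℕ → Impression A) :
    μ.assigned (n + 1) a ω =
      μ.assigned n a ω + if ¬ μ.Accepted n ω ∧ μ.choice n ω = a.succ then 1 else 0 := by
  simp only [Policy.assigned, Finset.range_add_one, Finset.filter_insert]
  split_ifs <;> simp

/-- The debt never exceeds the impressions left: when the two are equal, the null price and the
exclusion of option 0 force each impression to reduce the debt. At time N the debt must then be
zero. -/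
theorem remaining_invariant (hr : IsRegular r) (hy : IsTieFlow G r ρ v y) (hφ : IsFallback φ)
    (hC : ∑ a, C a ≤ N) {ω : ℕ → Impression A} (hω : ∀ n, ((ω n).2.2 : ℝ) < 1) (n : ℕ)
    (hn : n ≤ N) :
    ∑ a, remaining G r v y φ N C n (past n ω) a ≤ N - n ∧
      ∀ a, (bidPricePolicy G r v y φ N C).assigned n a ω +
        remaining G r v y φ N C n (past n ω) a = C a := by
  induction n with
  | zero => exact ⟨by simpa [remaining] using hC, fun a => by simp [remaining, Policy.assigned]⟩
  | succ n ih =>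
    obtain ⟨ih1, ih2⟩ := ih (by omega)
    set μ := bidPricePolicy G r v y φ N C with hμ
    set x := remaining G r v y φ N C n (past n ω) with hx
    have hmem : μ.choice n ω ∈ eligible (N - n) x :=
      bidTarget_mem_eligible hr hy hφ (by omega) x _ (hω n)
    have hle : ∀ a, remaining G r v y φ N C (n + 1) (past (n + 1) ω) a ≤ x a := fun a => by
      rw [remaining_succ]
      split_ifs <;> simp [hx]
    constructor
    · by_cases hlt : ∑ a, x a < N - n
      · have := Finset.sum_le_sum fun a (_ : a ∈ Finset.univ) => hle a
        omega
      -- The null price has acceptance probability zero, and acceptance is a strict inequality, so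
      -- no value of the uniform variable accepts.
      · have hacc : ¬ μ.Accepted n ω := by
          have : μ.s n ω = 0 := if_neg hlt
          rw [Policy.Accepted, this, not_lt]
          exact (ω n).2.1.2.1
        rw [eligible, if_neg hlt, active] at hmem
        obtain ⟨b, hb, hbc⟩ := Finset.mem_map.1 hmem
        have hb0 : 0 < x b := (Finset.mem_filter.1 hb).2
        have : ∑ a, remaining G r v y φ N C (n + 1) (past (n + 1) ω) a < ∑ a, x a := by
          refine Finset.sum_lt_sum (fun a _ => hle a) ⟨b, Finset.mem_univ b, ?_⟩
          rw [remaining_succ, if_pos ⟨hacc, hbc.symm⟩]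
          change x b - 1 < x b
          omega
        omega
    · intro a
      rw [Policy.assigned_succ, remaining_succ]
      have := ih2 a
      by_cases h : ¬ μ.Accepted n ω ∧ μ.choice n ω = a.succ
      -- The chosen advertiser is still owed an impression, so the truncated subtraction is a true
      -- one.
      · have hpos : 0 < x a := pos_of_mem_eligible (h.2 ▸ hmem)
        rw [if_pos h, if_pos h]
        change _ + 1 + (x a - 1) = C a
        omega
      · rw [if_neg h, if_neg h]
        exact this

theorem bidAccept_mem (hr : IsRegular r) (v : Fin A → ℝ) (m : ℕ) (x : Fin A → ℕ) (q : Fin A → ℝ) :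
    bidAccept r v m x q ∈ Set.Icc (0 : ℝ) 1 := by
  rw [bidAccept]
  split_ifs
  · exact hr.sStar_mem _
  · simp

theorem isAdmissible_bidPricePolicy [IsProbabilityMeasure G] (hr : IsRegular r)
    (hy : IsTieFlow G r ρ v y) (hφ : IsFallback φ) (hC : ∑ a, C a ≤ N) :
    (bidPricePolicy G r v y φ N C).IsAdmissible G N C where
  measurable_accept n := (measurable_bidAccept hr v (N - n)).comp
    (((measurable_remaining hr n).comp measurable_fst).prodMk measurable_snd)
  measurable_target n := (measurable_bidTarget (N - n)).comp
    (((measurable_remaining hr n).comp measurable_fst).prodMk measurable_snd)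
  accept_mem n h q := bidAccept_mem hr v _ _ q
  contracts := by
    filter_upwards [ae_pathLaw_lt_one] with ω hω a
    obtain ⟨h1, h2⟩ := remaining_invariant hr hy hφ hC hω N le_rfl
    have h3 := h2 a
    have h4 := Finset.single_le_sum (fun a _ => Nat.zero_le
      (remaining G r v y φ N C N (past N ω) a)) (Finset.mem_univ a)
    omega

end Admissible

end AdX

end

noncomputable section

namespace AdX

/-! ### The static bid-price policy before the first exhaustion of an option -/

section Interior

variable {A : ℕ} {G : Measure (Fin A → ℝ)} {r : ℝ → ℝ} {ρ v : Fin A → ℝ}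
  {y φ : Finset (Fin (A + 1)) → Fin (A + 1) → ℝ} {N : ℕ} {C : Fin A → ℕ}

/-- States in which all the options are still available. -/
def IsInterior (m : ℕ) (x : Fin A → ℕ) : Prop := (∀ a, 0 < x a) ∧ ∑ a, x a < m

theorem IsInterior.insert_active {m : ℕ} {x : Fin A → ℕ} (h : IsInterior m x) :
    insert 0 (active x) = Finset.univ := by
  refine Finset.eq_univ_iff_forall.2 fun a => ?_
  refine Fin.cases (Finset.mem_insert_self _ _) (fun b => ?_) a
  exact Finset.mem_insert_of_mem (mem_active.2 (h.1 b))

theorem IsInterior.eligible_eq {m : ℕ} {x : Fin A → ℕ} (h : IsInterior m x) :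
    eligible m x = Finset.univ := by
  rw [eligible, if_pos h.2, h.insert_active]

theorem IsInterior.bidAccept_eq {m : ℕ} {x : Fin A → ℕ} (h : IsInterior m x) (q : Fin A → ℝ) :
    bidAccept r v m x q = sStar r (maxAdjusted v q) := by
  rw [bidAccept, if_pos h.2, maxAdjusted]
  congr 1
  exact Finset.sup'_congr _ h.insert_active fun _ _ => rfl

theorem IsInterior.bidTarget_eq {m : ℕ} {x : Fin A → ℕ} (h : IsInterior m x) (q : Fin A → ℝ)
    (w : unitInterval) :
    bidTarget G r v y φ m x q w =
      draw (drawProb G r v y φ (argmaxIn v q Finset.univ) (argmaxIn v q Finset.univ)) w := by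
  rw [bidTarget, h.eligible_eq]

/-- The option that an impression uses up; accepted impressions use up the outside option. -/
def Policy.used (μ : Policy A) (n : ℕ) (x : (Fin n → Impression A) × Impression A) : Fin (A + 1) :=
  if (x.2.2.1 : ℝ) < μ.accept n x.1 x.2.1 then 0 else μ.target n x.1 x.2.1 x.2.2.2

theorem Policy.IsAdmissible.measurable_used [IsProbabilityMeasure G] {μ : Policy A}
    (hμ : μ.IsAdmissible G N C) (n : ℕ) :
    Measurable (μ.used n) :=
  Measurable.ite (measurableSet_lt (by fun_prop) (hμ.measurable_s n)) measurable_const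
    (hμ.measurable_choice n)

theorem Policy.used_eq_succ (μ : Policy A) (n : ℕ) (ω : ℕ → Impression A) (a : Fin A) :
    μ.used n (past n ω, ω n) = a.succ ↔ ¬ μ.Accepted n ω ∧ μ.choice n ω = a.succ := by
  change (if ((ω n).2.1 : ℝ) < μ.s n ω then 0 else μ.choice n ω) = a.succ ↔
    ¬ ((ω n).2.1 : ℝ) < μ.s n ω ∧ μ.choice n ω = a.succ
  by_cases h : ((ω n).2.1 : ℝ) < μ.s n ω
  · simp [h, (Fin.succ_ne_zero a).symm]
  · simp [h]

theorem measurable_static_draw :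
    Measurable fun z : (Fin A → ℝ) × unitInterval =>
      draw (drawProb G r v y φ (argmaxIn v z.1 Finset.univ) (argmaxIn v z.1 Finset.univ)) z.2 := by
  let _ : MeasurableSpace (Finset (Fin (A + 1))) := ⊤
  have : DiscreteMeasurableSpace (Finset (Fin (A + 1))) := ⟨fun _ => trivial⟩
  exact measurable_draw_comp (f := fun q => argmaxIn v q Finset.univ)
    (fun S => drawProb G r v y φ S S) (measurable_comp_argmaxIn v Finset.univ fun S => S)

variable [IsProbabilityMeasure G]

/-- In an interior state the expected yield of the present impression is the dual value. -/
theorem integral_stepYield_of_isInterior (hr : IsRegular r)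
    (hG : ∀ a, Integrable (fun q : Fin A → ℝ => q a) G) (hy : IsTieFlow G r ρ v y)
    (hφ : IsFallback φ) {n : ℕ} {h : Fin n → Impression A}
    (hh : IsInterior (N - n) (remaining G r v y φ N C n h)) :
    ∫ z, (bidPricePolicy G r v y φ N C).stepYield r n (h, z) ∂impressionLaw G = dual G r ρ v := by
  set D : (Fin A → ℝ) → unitInterval → Fin (A + 1) := fun q w =>
    draw (drawProb G r v y φ (argmaxIn v q Finset.univ) (argmaxIn v q Finset.univ)) w with hD
  have hstep : ∀ z, (bidPricePolicy G r v y φ N C).stepYield r n (h, z) =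
      r (sStar r (maxAdjusted v z.1)) +
        (1 - sStar r (maxAdjusted v z.1)) * quality z.1 (D z.1 z.2.2) := fun z => by
    simp only [Policy.stepYield, bidPricePolicy, hh.bidAccept_eq, hh.bidTarget_eq, hD]
  have hs := hr.measurable_sStar_maxAdjusted v
  have hs' : ∀ q, sStar r (maxAdjusted v q) ∈ Set.Icc (0 : ℝ) 1 := fun q => hr.sStar_mem _
  have hk : Measurable fun z : (Fin A → ℝ) × unitInterval => quality z.1 (D z.1 z.2) :=
    measurable_quality_uncurry measurable_fst measurable_static_draw
  have hrs : Integrable (fun q => r (sStar r (maxAdjusted v q))) G := hr.integrable_comp hs hs'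
  have hk2 : Integrable (fun z : Impression A =>
      (1 - sStar r (maxAdjusted v z.1)) * quality z.1 (D z.1 z.2.2)) (impressionLaw G) := by
    refine (integrable_fst_impressionLaw (integrable_sum_abs hG)).mono'
      (((hs.comp measurable_fst).const_sub 1).mul
        (hk.comp (f := fun z : Impression A => (z.1, z.2.2)) (by fun_prop))).aestronglyMeasurable
      (.of_forall fun z => ?_)
    rw [Real.norm_eq_abs, abs_mul, abs_of_nonneg (by linarith [(hs' z.1).2])]
    exact (mul_le_of_le_one_left (abs_nonneg _) (by linarith [(hs' z.1).1])).trans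
      (abs_quality_le _ _)
  have hdraw : ∀ q, ∫ w, quality q (D q w) = ∑ a, drawProb G r v y φ (argmaxIn v q Finset.univ)
      (argmaxIn v q Finset.univ) a * quality q a := fun q =>
    integral_draw (drawProb_nonneg hr hy hφ _ _)
      (sum_drawProb hφ _ (argmaxIn_nonempty v q Finset.univ_nonempty)) _
  have hw := integral_weighted (k := fun z : (Fin A → ℝ) × unitInterval => quality z.1 (D z.1 z.2))
    hs hs' hk (integrable_sum_abs hG) fun q w => abs_quality_le q _
  simp only [hdraw] at hw
  have hint : Integrable (fun q => (1 - sStar r (maxAdjusted v q)) *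
      ∑ a, drawProb G r v y φ (argmaxIn v q Finset.univ) (argmaxIn v q Finset.univ) a *
        quality q a) G := by
    have : ∀ q, (1 - sStar r (maxAdjusted v q)) *
      ∑ a, drawProb G r v y φ (argmaxIn v q Finset.univ) (argmaxIn v q Finset.univ) a *
        quality q a = ∑ a, ((1 - sStar r (maxAdjusted v q)) * drawProb G r v y φ
          (argmaxIn v q Finset.univ) (argmaxIn v q Finset.univ) a) * quality q a := fun q => by
      rw [Finset.mul_sum]
      exact Finset.sum_congr rfl fun a _ => by ring
    simp only [this]
    refine integrable_finsetSum _ fun a _ => (integrable_quality hG a).bdd_mul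
      (measurable_rejected_drawProb hr v a).aestronglyMeasurable (c := 1) (.of_forall fun q => ?_)
    have h := rejected_drawProb_mem hr hy hφ q
      (argmaxIn v q Finset.univ) (argmaxIn v q Finset.univ) a
    rw [Real.norm_eq_abs, abs_of_nonneg h.1]
    exact h.2
  simp only [hstep]
  rw [integral_add (integrable_fst_impressionLaw hrs) hk2, hw,
    integral_fun_fst (fun q => r (sStar r (maxAdjusted v q))), probReal_univ, one_smul,
    ← integral_add hrs hint]
  exact integral_static_yield hr hG hy hφ

/-- In an interior state the options are used up at the rates `ρ`. -/
theorem integral_used_of_isInterior (hr : IsRegular r) (hy : IsTieFlow G r ρ v y)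
    (hφ : IsFallback φ) (hC : ∑ a, C a ≤ N) {n : ℕ} {h : Fin n → Impression A}
    (hh : IsInterior (N - n) (remaining G r v y φ N C n h)) (a : Fin (A + 1)) :
    ∫ z, (if (bidPricePolicy G r v y φ N C).used n (h, z) = a then (1 : ℝ) else 0)
      ∂impressionLaw G = fullRatio ρ a := by
  set μ := bidPricePolicy G r v y φ N C with hμ_def
  have hμ := isAdmissible_bidPricePolicy (C := C) hr hy hφ hC
  set D : (Fin A → ℝ) → unitInterval → Fin (A + 1) := fun q w =>
    draw (drawProb G r v y φ (argmaxIn v q Finset.univ) (argmaxIn v q Finset.univ)) w with hD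
  have hsucc : ∀ b : Fin A, ∫ z, (if μ.used n (h, z) = b.succ then (1 : ℝ) else 0)
      ∂impressionLaw G = ρ b := fun b => by
    have h1 : ∀ z, (if μ.used n (h, z) = b.succ then (1 : ℝ) else 0) =
        if (z.2.1 : ℝ) < sStar r (maxAdjusted v z.1) then 0
        else if D z.1 z.2.2 = b.succ then 1 else 0 := fun z => by
      simp only [hμ_def, Policy.used, bidPricePolicy, hh.bidAccept_eq, hh.bidTarget_eq, hD]
      split_ifs <;> simp_all [(Fin.succ_ne_zero b).symm]
    have hk : Measurable fun z : (Fin A → ℝ) × unitInterval =>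
        if D z.1 z.2 = b.succ then (1 : ℝ) else 0 :=
      Measurable.ite (measurable_static_draw (measurableSet_singleton b.succ)) measurable_const
        measurable_const
    simp only [h1]
    rw [integral_if_rejected
      (k := fun z : (Fin A → ℝ) × unitInterval => if D z.1 z.2 = b.succ then (1 : ℝ) else 0)
      (hr.measurable_sStar_maxAdjusted v) (fun q => hr.sStar_mem _) hk (integrable_const 1)
      fun q w => by dsimp only; split_ifs <;> simp]
    rw [← integral_rejected_drawProb (φ := φ) hr hy b]
    refine integral_congr_ae (.of_forall fun q => ?_)
    dsimp only
    congr 1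
    refine (integral_draw (drawProb_nonneg hr hy hφ _ _)
      (sum_drawProb hφ _ (argmaxIn_nonempty v q Finset.univ_nonempty))
      fun c => if c = b.succ then (1 : ℝ) else 0).trans ?_
    simp
  refine Fin.cases ?_ (fun b => ?_) a
  · have hmeas : ∀ c, Integrable (fun z => if μ.used n (h, z) = c then (1 : ℝ) else 0)
        (impressionLaw G) := fun c =>
      .of_bound (Measurable.ite (((hμ.measurable_used n).comp (f := fun z => (h, z))
        (by fun_prop)) (measurableSet_singleton c)) measurable_const
          measurable_const).aestronglyMeasurable 1 (.of_forall fun z => by split_ifs <;> simp)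
    -- Each impression uses exactly one option, so the rate of option 0, which combines acceptance
    -- and discarding, is the complement of the others.
    have htot : ∑ c, ∫ z, (if μ.used n (h, z) = c then (1 : ℝ) else 0) ∂impressionLaw G = 1 := by
      rw [← integral_finsetSum _ fun c _ => hmeas c]
      simp
    rw [Fin.sum_univ_succ] at htot
    simp only [hsucc] at htot
    rw [fullRatio_zero]
    linarith
  · rw [hsucc, fullRatio_succ]

end Interior

end AdX

end

noncomputable section

namespace AdX

/-! ### The number of impressions before the first exhaustion -/

section Exhaustion

variable {A : ℕ} {G : Measure (Fin A → ℝ)} {r : ℝ → ℝ} {ρ v : Fin A → ℝ}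
  {y φ : Finset (Fin (A + 1)) → Fin (A + 1) → ℝ} {N : ℕ} {C : Fin A → ℕ}

open Classical in
/-- Indicator that the state before impression `n` is interior. -/
def alive (G : Measure (Fin A → ℝ)) (r : ℝ → ℝ) (v : Fin A → ℝ)
    (y φ : Finset (Fin (A + 1)) → Fin (A + 1) → ℝ) (N : ℕ) (C : Fin A → ℕ) (n : ℕ)
    (h : Fin n → Impression A) : ℝ :=
  if IsInterior (N - n) (remaining G r v y φ N C n h) then 1 else 0

theorem alive_eq_zero_or_one (n : ℕ) (h : Fin n → Impression A) :
    alive G r v y φ N C n h = 0 ∨ alive G r v y φ N C n h = 1 := by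
  rw [alive]; split_ifs <;> simp

theorem alive_mem (n : ℕ) (h : Fin n → Impression A) :
    alive G r v y φ N C n h ∈ Set.Icc (0 : ℝ) 1 := by
  rcases alive_eq_zero_or_one (G := G) (r := r) (v := v) (y := y) (φ := φ) (N := N) (C := C) n h
    with h | h <;> simp [h]

theorem measurable_alive (hr : IsRegular r) (n : ℕ) : Measurable (alive G r v y φ N C n) :=
  (measurable_from_top (α := Fin A → ℕ)
    (f := fun x => open Classical in if IsInterior (N - n) x then (1 : ℝ) else 0)).comp
    ((measurable_remaining hr n).mono le_rfl (by
      intro s _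
      exact (Set.to_countable s).measurableSet))

/-- An impression lowers the debt by at most one and the time to go by exactly one, so the interior
is never re-entered. The number of interior times is therefore the first exhaustion time. -/
theorem isInterior_of_succ {n : ℕ} {ω : ℕ → Impression A}
    (h : IsInterior (N - (n + 1)) (remaining G r v y φ N C (n + 1) (past (n + 1) ω))) :
    IsInterior (N - n) (remaining G r v y φ N C n (past n ω)) := by
  classical
  set x := remaining G r v y φ N C n (past n ω) with hx
  have hle : ∀ a, remaining G r v y φ N C (n + 1) (past (n + 1) ω) a ≤ x a := fun a => by
    rw [remaining_succ]
    split_ifs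
    exacts [Nat.sub_le _ _, le_rfl]
  refine ⟨fun a => (h.1 a).trans_le (hle a), ?_⟩
  have hsum : ∑ a, x a ≤ ∑ a, remaining G r v y φ N C (n + 1) (past (n + 1) ω) a + 1 := by
    have h1 : ∀ a, x a ≤ remaining G r v y φ N C (n + 1) (past (n + 1) ω) a +
        if (bidPricePolicy G r v y φ N C).choice n ω = a.succ then 1 else 0 := fun a => by
      rw [remaining_succ]
      by_cases hc : (bidPricePolicy G r v y φ N C).choice n ω = a.succ
      · rw [if_pos hc]
        split_ifs
        · change x a ≤ x a - 1 + 1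
          omega
        · exact Nat.le_succ _
      · rw [if_neg hc, if_neg fun h => hc h.2]
        exact le_rfl
    refine (Finset.sum_le_sum fun a _ => h1 a).trans ?_
    rw [Finset.sum_add_distrib]
    refine Nat.add_le_add_left ?_ _
    rw [Finset.sum_boole, Nat.cast_id, Finset.card_le_one]
    simp only [Finset.mem_filter, Finset.mem_univ, true_and]
    intro a ha b hb
    exact Fin.succ_injective A (ha.symm.trans hb)
  have := h.2
  omega

open Classical in
/-- How often the option `a` is used up before impression `n`, and before the first exhaustion. -/
def usage (G : Measure (Fin A → ℝ)) (r : ℝ → ℝ) (v : Fin A → ℝ)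
    (y φ : Finset (Fin (A + 1)) → Fin (A + 1) → ℝ) (N : ℕ) (C : Fin A → ℕ) (n : ℕ)
    (a : Fin (A + 1)) (ω : ℕ → Impression A) : ℕ :=
  ∑ k ∈ Finset.range n, if IsInterior (N - k) (remaining G r v y φ N C k (past k ω)) ∧
    (bidPricePolicy G r v y φ N C).used k (past k ω, ω k) = a then 1 else 0

/-- Usage is recorded only in interior states. The second alternative, where the books balance, also
covers the first state outside the interior; there the exhausted option is identified, and the first
alternative preserves it. -/
theorem usage_invariant (hC : ∀ a, (C a : ℝ) = N * ρ a) (ω : ℕ → Impression A) (n : ℕ)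
    (hn : n ≤ N) :
    (¬ IsInterior (N - n) (remaining G r v y φ N C n (past n ω)) ∧
      ∃ a, N * fullRatio ρ a ≤ usage G r v y φ N C n a ω) ∨
    ((∀ a, remaining G r v y φ N C n (past n ω) a + usage G r v y φ N C n a.succ ω = C a) ∧
      ∑ a, usage G r v y φ N C n a ω = n) := by
  classical
  induction n with
  | zero => exact Or.inr ⟨fun a => by simp [remaining, usage], by simp [usage]⟩
  | succ n ih =>
    set x := remaining G r v y φ N C n (past n ω) with hx
    have hsucc : ∀ a, usage G r v y φ N C (n + 1) a ω = usage G r v y φ N C n a ω +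
        if IsInterior (N - n) x ∧
          (bidPricePolicy G r v y φ N C).used n (past n ω, ω n) = a then 1 else 0 := fun a => by
      rw [usage, Finset.sum_range_succ, ← usage]
    by_cases hint : IsInterior (N - n) x
    · right
      rcases ih (by omega) with ⟨h, -⟩ | ⟨h1, h2⟩
      · exact absurd hint h
      constructor
      · intro a
        rw [hsucc, remaining_succ]
        have h3 := h1 a
        have h4 := hint.1 a
        by_cases hc : ¬ (bidPricePolicy G r v y φ N C).Accepted n ω ∧
          (bidPricePolicy G r v y φ N C).choice n ω = a.succ
        · rw [if_pos hc, if_pos ⟨hint, (Policy.used_eq_succ _ n ω a).2 hc⟩]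
          change x a - 1 + _ = _
          omega
        · rw [if_neg hc, if_neg fun h => hc ((Policy.used_eq_succ _ n ω a).1 h.2)]
          exact h3
      · simp only [hsucc, Finset.sum_add_distrib, h2]
        simp [hint]
    · left
      refine ⟨fun h => hint (isInterior_of_succ h), ?_⟩
      have hex : ∃ a, N * fullRatio ρ a ≤ usage G r v y φ N C n a ω := by
        rcases ih (by omega) with ⟨-, h⟩ | ⟨h1, h2⟩
        · exact h
        by_cases hpos : ∀ a, 0 < x a
        · have hge : N - n ≤ ∑ a, x a := by
            by_contra hlt
            exact hint ⟨hpos, by omega⟩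
          -- No room to discard means Σ x_a ≥ N - n. As the total usage is n, option 0 has been used
          -- at least N - Σ C_a = Nρ₀ times.
          refine ⟨0, ?_⟩
          have h3 : ∑ a, x a + ∑ a : Fin A, usage G r v y φ N C n a.succ ω = ∑ a, C a := by
            rw [← Finset.sum_add_distrib]
            exact Finset.sum_congr rfl fun a _ => h1 a
          rw [Fin.sum_univ_succ] at h2
          have h4 : N ≤ usage G r v y φ N C n 0 ω + ∑ a, C a := by omega
          have h5 : (N : ℝ) ≤ usage G r v y φ N C n 0 ω + ∑ a, (C a : ℝ) := by exact_mod_cast h4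
          simp only [hC, ← Finset.mul_sum] at h5
          rw [fullRatio_zero]
          linarith
        · push Not at hpos
          obtain ⟨a, ha⟩ := hpos
          refine ⟨a.succ, ?_⟩
          have h3 : usage G r v y φ N C n a.succ ω = C a := by
            have := h1 a
            omega
          rw [h3, hC, fullRatio_succ]
      obtain ⟨a, ha⟩ := hex
      refine ⟨a, ha.trans ?_⟩
      rw [hsucc]
      exact_mod_cast Nat.le_add_right _ _

/-- If no exhaustion was recorded by time N, the usages sum to N, which is also the sum of the
shares Nρ_a; not all of them can fall short. -/
theorem exists_le_usage (hC : ∀ a, (C a : ℝ) = N * ρ a) (ω : ℕ → Impression A) :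
    ∃ a, N * fullRatio ρ a ≤ usage G r v y φ N C N a ω := by
  rcases usage_invariant (G := G) (r := r) (v := v) (y := y) (φ := φ) hC ω N le_rfl
    with ⟨-, h⟩ | ⟨-, h⟩
  · exact h
  · by_contra! hlt
    have h1 := Finset.sum_lt_sum_of_nonempty Finset.univ_nonempty fun a (_ : a ∈ Finset.univ) =>
      hlt a
    rw [← Finset.mul_sum, sum_fullRatio, mul_one] at h1
    have : (N : ℝ) = ∑ a, (usage G r v y φ N C N a ω : ℝ) := by exact_mod_cast h.symm
    linarith

/-! ### The compensated usage as a square-integrable martingale -/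

/-- The compensated use of the option `a` by one impression. -/
def deviation (G : Measure (Fin A → ℝ)) (r : ℝ → ℝ) (ρ v : Fin A → ℝ)
    (y φ : Finset (Fin (A + 1)) → Fin (A + 1) → ℝ) (N : ℕ) (C : Fin A → ℕ) (a : Fin (A + 1))
    (n : ℕ) (x : (Fin n → Impression A) × Impression A) : ℝ :=
  alive G r v y φ N C n x.1 *
    ((if (bidPricePolicy G r v y φ N C).used n x = a then 1 else 0) - fullRatio ρ a)

/-- The compensated use of the option `a` by the first `n` impressions. -/
def totalDeviation (G : Measure (Fin A → ℝ)) (r : ℝ → ℝ) (ρ v : Fin A → ℝ)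
    (y φ : Finset (Fin (A + 1)) → Fin (A + 1) → ℝ) (N : ℕ) (C : Fin A → ℕ) (a : Fin (A + 1))
    (n : ℕ) (h : Fin n → Impression A) : ℝ :=
  ∑ k : Fin n, deviation G r ρ v y φ N C a k (fun i => h ⟨i, i.2.trans k.2⟩, h k)

theorem totalDeviation_past (a : Fin (A + 1)) (n : ℕ) (ω : ℕ → Impression A) :
    totalDeviation G r ρ v y φ N C a n (past n ω) =
      ∑ k ∈ Finset.range n, deviation G r ρ v y φ N C a k (past k ω, ω k) :=
  (Finset.sum_range fun k => deviation G r ρ v y φ N C a k (past k ω, ω k)).symm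

theorem totalDeviation_eq (a : Fin (A + 1)) (n : ℕ) (ω : ℕ → Impression A) :
    totalDeviation G r ρ v y φ N C a n (past n ω) = usage G r v y φ N C n a ω -
      fullRatio ρ a * ∑ k ∈ Finset.range n, alive G r v y φ N C k (past k ω) := by
  classical
  rw [totalDeviation_past, usage, Nat.cast_sum, Finset.mul_sum, ← Finset.sum_sub_distrib]
  refine Finset.sum_congr rfl fun k _ => ?_
  rw [deviation, alive, Nat.cast_ite]
  by_cases h : IsInterior (N - k) (remaining G r v y φ N C k (past k ω)) <;> simp [h]

/-- The impressions that remain at the first exhaustion are accounted for by the deviation of one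
of the options. -/
theorem exists_sub_le_totalDeviation (hρ : ∀ a, 0 < ρ a) (hρ_sum : ∑ a, ρ a < 1)
    (hC : ∀ a, (C a : ℝ) = N * ρ a) (ω : ℕ → Impression A) :
    ∃ a, N - ∑ k ∈ Finset.range N, alive G r v y φ N C k (past k ω) ≤
      totalDeviation G r ρ v y φ N C a N (past N ω) / fullRatio ρ a := by
  obtain ⟨a, ha⟩ := exists_le_usage (G := G) (r := r) (v := v) (y := y) (φ := φ) hC ω
  refine ⟨a, ?_⟩
  rw [le_div_iff₀ (fullRatio_pos hρ hρ_sum a), totalDeviation_eq]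
  linarith

theorem fullRatio_mem (hρ : ∀ a, 0 < ρ a) (hρ_sum : ∑ a, ρ a < 1) (a : Fin (A + 1)) :
    fullRatio ρ a ∈ Set.Icc (0 : ℝ) 1 := by
  refine ⟨(fullRatio_pos hρ hρ_sum a).le, ?_⟩
  rw [← sum_fullRatio ρ]
  exact Finset.single_le_sum (fun b _ => (fullRatio_pos hρ hρ_sum b).le) (Finset.mem_univ a)

theorem abs_deviation_le (hρ : ∀ a, 0 < ρ a) (hρ_sum : ∑ a, ρ a < 1) (a : Fin (A + 1)) (n : ℕ)
    (x : (Fin n → Impression A) × Impression A) : |deviation G r ρ v y φ N C a n x| ≤ 1 := by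
  have h1 := alive_mem (G := G) (r := r) (v := v) (y := y) (φ := φ) (N := N) (C := C) n x.1
  have h2 := fullRatio_mem hρ hρ_sum a
  rw [deviation, abs_mul, abs_of_nonneg h1.1]
  refine mul_le_one₀ h1.2 (abs_nonneg _) ?_
  rw [abs_le]
  split_ifs <;> constructor <;> linarith [h2.1, h2.2]

theorem abs_totalDeviation_le (hρ : ∀ a, 0 < ρ a) (hρ_sum : ∑ a, ρ a < 1) (a : Fin (A + 1)) (n : ℕ)
    (h : Fin n → Impression A) : |totalDeviation G r ρ v y φ N C a n h| ≤ n := by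
  refine (Finset.abs_sum_le_sum_abs _ _).trans ?_
  refine (Finset.sum_le_sum (g := fun _ => (1 : ℝ)) fun k _ => ?_).trans (by simp)
  exact abs_deviation_le hρ hρ_sum a k _

variable [IsProbabilityMeasure G]

theorem measurable_used_indicator (hr : IsRegular r) (hy : IsTieFlow G r ρ v y)
    (hφ : IsFallback φ) (hC : ∑ a, C a ≤ N) (a : Fin (A + 1)) (n : ℕ) :
    Measurable fun x => if (bidPricePolicy G r v y φ N C).used n x = a then (1 : ℝ) else 0 :=
  Measurable.ite ((isAdmissible_bidPricePolicy hr hy hφ hC).measurable_used n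
    (measurableSet_singleton a)) measurable_const measurable_const

theorem measurable_deviation (hr : IsRegular r) (hy : IsTieFlow G r ρ v y)
    (hφ : IsFallback φ) (hC : ∑ a, C a ≤ N) (a : Fin (A + 1)) (n : ℕ) :
    Measurable (deviation G r ρ v y φ N C a n) :=
  ((measurable_alive hr n).comp measurable_fst).mul
    ((measurable_used_indicator hr hy hφ hC a n).sub_const _)

theorem measurable_totalDeviation (hr : IsRegular r) (hy : IsTieFlow G r ρ v y)
    (hφ : IsFallback φ) (hC : ∑ a, C a ≤ N) (a : Fin (A + 1)) (n : ℕ) :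
    Measurable (totalDeviation G r ρ v y φ N C a n) :=
  Finset.measurable_fun_sum _ fun k _ => (measurable_deviation hr hy hφ hC a k).comp
    ((measurable_pi_lambda _ fun _ => measurable_pi_apply _).prodMk (measurable_pi_apply k))

theorem integrable_alive (hr : IsRegular r) (n : ℕ) :
    Integrable (fun ω => alive G r v y φ N C n (past n ω)) (pathLaw G) :=
  .of_bound ((measurable_alive hr n).comp (measurable_past n)).aestronglyMeasurable 1
    (.of_forall fun ω => by
      have h := alive_mem (G := G) (r := r) (v := v) (y := y) (φ := φ) (N := N) (C := C) n
        (past n ω)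
      rw [Real.norm_eq_abs, abs_of_nonneg h.1]
      exact h.2)

/-- Given the past, an option is used up at rate `ρ` before the first exhaustion. -/
theorem integral_mul_alive_mul_used (hr : IsRegular r) (hy : IsTieFlow G r ρ v y)
    (hφ : IsFallback φ) (hC : ∑ a, C a ≤ N) (a : Fin (A + 1)) (n : ℕ)
    {f : (Fin n → Impression A) → ℝ} (hf : Measurable f) {c : ℝ} (hc : ∀ h, |f h| ≤ c) :
    ∫ ω, f (past n ω) * alive G r v y φ N C n (past n ω) *
      (if (bidPricePolicy G r v y φ N C).used n (past n ω, ω n) = a then 1 else 0) ∂pathLaw G =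
    ∫ ω, f (past n ω) * alive G r v y φ N C n (past n ω) * fullRatio ρ a ∂pathLaw G := by
  rw [integral_pathLaw (F := fun x => f x.1 * alive G r v y φ N C n x.1 *
      (if (bidPricePolicy G r v y φ N C).used n x = a then 1 else 0))
    (((hf.comp measurable_fst).mul ((measurable_alive hr n).comp measurable_fst)).mul
      (measurable_used_indicator hr hy hφ hC a n)) (integrable_const c)]
  · refine integral_congr_ae (.of_forall fun ω => ?_)
    dsimp only
    rw [integral_const_mul]
    by_cases h : IsInterior (N - n) (remaining G r v y φ N C n (past n ω))
    · rw [integral_used_of_isInterior hr hy hφ hC h]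
    · simp [alive, h]
  · intro h z
    have h1 := alive_mem (G := G) (r := r) (v := v) (y := y) (φ := φ) (N := N) (C := C) n h
    dsimp only
    rw [mul_assoc, abs_mul]
    refine (mul_le_of_le_one_right (abs_nonneg _) ?_).trans (hc h)
    rw [abs_mul, abs_of_nonneg h1.1]
    refine mul_le_one₀ h1.2 (abs_nonneg _) ?_
    split_ifs <;> simp

/-- The martingale difference property, tested against bounded functions of the past. A constant
test function gives mean zero, and the accumulated deviation gives orthogonality of increments. -/
theorem integral_mul_deviation (hr : IsRegular r) (hy : IsTieFlow G r ρ v y)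
    (hφ : IsFallback φ) (hC : ∑ a, C a ≤ N) (a : Fin (A + 1)) (n : ℕ)
    {f : (Fin n → Impression A) → ℝ} (hf : Measurable f) {c : ℝ} (hc : ∀ h, |f h| ≤ c) :
    ∫ ω, f (past n ω) * deviation G r ρ v y φ N C a n (past n ω, ω n) ∂pathLaw G = 0 := by
  have hmeas : Measurable fun ω => f (past n ω) * alive G r v y φ N C n (past n ω) :=
    (hf.comp (measurable_past n)).mul ((measurable_alive hr n).comp (measurable_past n))
  have hbound : ∀ ω, ‖f (past n ω) * alive G r v y φ N C n (past n ω)‖ ≤ c := fun ω => by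
    have h1 := alive_mem (G := G) (r := r) (v := v) (y := y) (φ := φ) (N := N) (C := C) n
      (past n ω)
    rw [Real.norm_eq_abs, abs_mul, abs_of_nonneg h1.1]
    exact (mul_le_of_le_one_right (abs_nonneg _) h1.2).trans (hc _)
  have hint : Integrable (fun ω => f (past n ω) * alive G r v y φ N C n (past n ω)) (pathLaw G) :=
    .of_bound hmeas.aestronglyMeasurable c (.of_forall hbound)
  have hu : Measurable fun ω : ℕ → Impression A =>
      if (bidPricePolicy G r v y φ N C).used n (past n ω, ω n) = a then (1 : ℝ) else 0 :=
    (measurable_used_indicator hr hy hφ hC a n).comp (f := fun ω => (past n ω, ω n)) (by fun_prop)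
  simp only [deviation, mul_sub, ← mul_assoc]
  rw [integral_sub (hint.mul_bdd (c := 1) hu.aestronglyMeasurable (.of_forall fun ω => by
      split_ifs <;> simp)) (hint.mul_const _),
    integral_mul_alive_mul_used hr hy hφ hC a n hf hc, sub_self]

theorem integral_deviation_sq (hr : IsRegular r) (hy : IsTieFlow G r ρ v y)
    (hφ : IsFallback φ) (hC : ∑ a, C a ≤ N) (a : Fin (A + 1)) (n : ℕ) :
    ∫ ω, deviation G r ρ v y φ N C a n (past n ω, ω n) ^ 2 ∂pathLaw G =
      fullRatio ρ a * (1 - fullRatio ρ a) * ∫ ω, alive G r v y φ N C n (past n ω) ∂pathLaw G := by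
  have h1 := integral_mul_alive_mul_used hr hy hφ hC a n (f := fun _ => 1) measurable_const
    (c := 1) (by simp)
  simp only [one_mul, integral_mul_const] at h1
  have hu : Measurable fun ω : ℕ → Impression A =>
      if (bidPricePolicy G r v y φ N C).used n (past n ω, ω n) = a then (1 : ℝ) else 0 :=
    (measurable_used_indicator hr hy hφ hC a n).comp (f := fun ω => (past n ω, ω n)) (by fun_prop)
  have hint := (integrable_alive (v := v) (y := y) (φ := φ) (N := N) (C := C) (G := G) hr n)
  -- Both factors are 0-1 valued, so the square is linear in the indicators and yields the Bernoulli
  -- variance times the probability of being interior.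
  have h2 : ∀ ω, deviation G r ρ v y φ N C a n (past n ω, ω n) ^ 2 =
      (1 - 2 * fullRatio ρ a) * (alive G r v y φ N C n (past n ω) *
        (if (bidPricePolicy G r v y φ N C).used n (past n ω, ω n) = a then 1 else 0)) +
      fullRatio ρ a ^ 2 * alive G r v y φ N C n (past n ω) := fun ω => by
    rw [deviation]
    rcases alive_eq_zero_or_one (G := G) (r := r) (v := v) (y := y) (φ := φ) (N := N) (C := C) n
      (past n ω) with h | h <;> rw [h] <;> split_ifs <;> ring
  simp only [h2]
  rw [integral_add ((hint.mul_bdd (c := 1) hu.aestronglyMeasurable (.of_forall fun ω => by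
      split_ifs <;> simp)).const_mul _) (hint.const_mul _), integral_const_mul, integral_const_mul,
    h1]
  ring

theorem integral_totalDeviation (hr : IsRegular r) (hρ : ∀ a, 0 < ρ a) (hρ_sum : ∑ a, ρ a < 1)
    (hy : IsTieFlow G r ρ v y) (hφ : IsFallback φ) (hC : ∑ a, C a ≤ N) (a : Fin (A + 1)) (n : ℕ) :
    ∫ ω, totalDeviation G r ρ v y φ N C a n (past n ω) ∂pathLaw G = 0 ∧
    ∫ ω, totalDeviation G r ρ v y φ N C a n (past n ω) ^ 2 ∂pathLaw G =
      fullRatio ρ a * (1 - fullRatio ρ a) *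
        ∑ k ∈ Finset.range n, ∫ ω, alive G r v y φ N C k (past k ω) ∂pathLaw G := by
  induction n with
  | zero => simp [totalDeviation]
  | succ n ih =>
    set W : (ℕ → Impression A) → ℝ := fun ω => totalDeviation G r ρ v y φ N C a n (past n ω)
      with hW
    set B : (ℕ → Impression A) → ℝ := fun ω => deviation G r ρ v y φ N C a n (past n ω, ω n)
      with hB
    have hWm : Measurable W := (measurable_totalDeviation hr hy hφ hC a n).comp (measurable_past n)
    have hBm : Measurable B := (measurable_deviation hr hy hφ hC a n).comp
      (f := fun ω => (past n ω, ω n)) (by fun_prop)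
    have hWb : ∀ ω, ‖W ω‖ ≤ n := fun ω => abs_totalDeviation_le hρ hρ_sum a n _
    have hBb : ∀ ω, ‖B ω‖ ≤ 1 := fun ω => abs_deviation_le hρ hρ_sum a n _
    have hWi : Integrable W (pathLaw G) :=
      .of_bound hWm.aestronglyMeasurable n (.of_forall hWb)
    have hBi : Integrable B (pathLaw G) :=
      .of_bound hBm.aestronglyMeasurable 1 (.of_forall hBb)
    have hsucc : ∀ ω, totalDeviation G r ρ v y φ N C a (n + 1) (past (n + 1) ω) = W ω + B ω :=
      fun ω => by rw [hW, hB]; simp only [totalDeviation_past, Finset.sum_range_succ]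
    have hB0 : ∫ ω, B ω ∂pathLaw G = 0 := by
      simpa using integral_mul_deviation hr hy hφ hC a n (f := fun _ => 1) measurable_const
        (c := 1) (by simp)
    have hWB : ∫ ω, W ω * B ω ∂pathLaw G = 0 :=
      integral_mul_deviation hr hy hφ hC a n (measurable_totalDeviation hr hy hφ hC a n)
        (abs_totalDeviation_le hρ hρ_sum a n)
    have hWBi : Integrable (fun ω => W ω * B ω) (pathLaw G) :=
      hWi.mul_bdd hBm.aestronglyMeasurable (.of_forall hBb)
    have hWWi : Integrable (fun ω => W ω ^ 2) (pathLaw G) := by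
      simpa only [sq] using hWi.mul_bdd hWm.aestronglyMeasurable (.of_forall hWb)
    have hBBi : Integrable (fun ω => B ω ^ 2) (pathLaw G) := by
      simpa only [sq] using hBi.mul_bdd hBm.aestronglyMeasurable (.of_forall hBb)
    have hsq : ∀ ω, (W ω + B ω) ^ 2 = W ω ^ 2 + 2 * (W ω * B ω) + B ω ^ 2 := fun ω => by ring
    simp only [hsucc]
    constructor
    · rw [integral_add hWi hBi, hB0, add_zero]
      exact ih.1
    · simp only [hsq]
      have hlin : Integrable (fun ω => W ω ^ 2 + 2 * (W ω * B ω)) (pathLaw G) :=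
        hWWi.add (hWBi.const_mul 2)
      rw [integral_add hlin hBBi, integral_add hWWi (hWBi.const_mul 2),
        integral_const_mul, hWB, Finset.sum_range_succ, mul_add]
      have h1 := ih.2
      have h2 := integral_deviation_sq hr hy hφ hC a n
      linarith

end Exhaustion

end AdX

end

noncomputable section

namespace AdX

/-! ### The expected maximum of centred variables -/

/-- A Samuelson-type bound on one entry's distance from the mean, proved by Cauchy–Schwarz on the
other A entries; A/(A + 1) is the factor in K(ρ). The mean term is kept because it integrates to
zero. -/
theorem le_mean_add_sqrt {A : ℕ} (z : Fin (A + 1) → ℝ) (a : Fin (A + 1)) :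
    z a ≤ (∑ b, z b) / ((A : ℝ) + 1) +
      Real.sqrt ((A : ℝ) / ((A : ℝ) + 1) * ∑ b, z b ^ 2) := by
  rw [← sub_le_iff_le_add']
  refine Real.le_sqrt_of_sq_le ?_
  have hA : (0 : ℝ) < (A : ℝ) + 1 := by positivity
  rw [← Finset.add_sum_erase _ z (Finset.mem_univ a),
    ← Finset.add_sum_erase _ (fun b => z b ^ 2) (Finset.mem_univ a)]
  have hcs := sq_sum_le_card_mul_sum_sq (s := Finset.univ.erase a) (f := z)
  rw [Finset.card_erase_of_mem (Finset.mem_univ a), Finset.card_univ, Fintype.card_fin,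
    Nat.add_sub_cancel] at hcs
  set T := ∑ b ∈ Finset.univ.erase a, z b
  set Q := ∑ b ∈ Finset.univ.erase a, z b ^ 2
  have h1 : z a - (z a + T) / ((A : ℝ) + 1) = (A * z a - T) / ((A : ℝ) + 1) := by
    field_simp
    ring
  rw [h1, div_pow, div_mul_eq_mul_div, div_le_div_iff₀ (by positivity) hA]
  have h2 : (A * z a - T) ^ 2 ≤ ((A : ℝ) + 1) * (A * (z a ^ 2 + Q)) := by
    nlinarith [mul_nonneg (Nat.cast_nonneg (α := ℝ) A) (sq_nonneg (z a + T)),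
      mul_le_mul_of_nonneg_left hcs hA.le]
  nlinarith

theorem integral_sqrt_le {Ω : Type*} [MeasurableSpace Ω] {P : Measure Ω} [IsProbabilityMeasure P]
    {g : Ω → ℝ} (hg : ∀ ω, 0 ≤ g ω) (hgi : Integrable g P)
    (hsi : Integrable (fun ω => Real.sqrt (g ω)) P) :
    ∫ ω, Real.sqrt (g ω) ∂P ≤ Real.sqrt (∫ ω, g ω ∂P) :=
  Real.strictConcaveOn_sqrt.concaveOn.le_map_integral Real.continuous_sqrt.continuousOn
    isClosed_Ici (.of_forall hg) hgi hsi

/-! ### Performance of the static bid-price policy -/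

section Performance

variable {A : ℕ} {G : Measure (Fin A → ℝ)} [IsProbabilityMeasure G] {r : ℝ → ℝ} {ρ v : Fin A → ℝ}
  {y φ : Finset (Fin (A + 1)) → Fin (A + 1) → ℝ} {N : ℕ} {C : Fin A → ℕ}

theorem sum_le_of_eq_mul (hρ_sum : ∑ a, ρ a < 1) (hC : ∀ a, (C a : ℝ) = N * ρ a) :
    ∑ a, C a ≤ N := by
  have h : ((∑ a, C a : ℕ) : ℝ) ≤ N := by
    push_cast
    simp only [hC, ← Finset.mul_sum]
    exact mul_le_of_le_one_right (Nat.cast_nonneg N) hρ_sum.le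
  exact_mod_cast h

/-- The expected number of impressions before the first exhaustion. -/
theorem sub_le_sum_integral_alive (hr : IsRegular r) (hρ : ∀ a, 0 < ρ a) (hρ_sum : ∑ a, ρ a < 1)
    (hy : IsTieFlow G r ρ v y) (hφ : IsFallback φ) (hC : ∀ a, (C a : ℝ) = N * ρ a) :
    N - Real.sqrt N * K ρ ≤
      ∑ k ∈ Finset.range N, ∫ ω, alive G r v y φ N C k (past k ω) ∂pathLaw G := by
  have hC' := sum_le_of_eq_mul hρ_sum hC
  set τ := ∑ k ∈ Finset.range N, ∫ ω, alive G r v y φ N C k (past k ω) ∂pathLaw G with hτ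
  set Z : Fin (A + 1) → (ℕ → Impression A) → ℝ := fun a ω =>
    totalDeviation G r ρ v y φ N C a N (past N ω) / fullRatio ρ a with hZ
  have hpos := fullRatio_pos hρ hρ_sum
  have hZm : ∀ a, Measurable (Z a) := fun a =>
    ((measurable_totalDeviation hr hy hφ hC' a N).comp (measurable_past N)).div_const _
  have hZb : ∀ a ω, ‖Z a ω‖ ≤ N / fullRatio ρ a := fun a ω => by
    rw [Real.norm_eq_abs, abs_div, abs_of_pos (hpos a)]
    exact div_le_div_of_nonneg_right (abs_totalDeviation_le hρ hρ_sum a N _) (hpos a).le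
  have hZi : ∀ a, Integrable (Z a) (pathLaw G) := fun a =>
    .of_bound (hZm a).aestronglyMeasurable _ (.of_forall (hZb a))
  have hZsq : ∀ a, Integrable (fun ω => Z a ω ^ 2) (pathLaw G) := fun a => by
    simpa only [sq] using (hZi a).mul_bdd (hZm a).aestronglyMeasurable (.of_forall (hZb a))
  have hZ0 : ∀ a, ∫ ω, Z a ω ∂pathLaw G = 0 := fun a => by
    rw [hZ]
    simp only [integral_div, (integral_totalDeviation hr hρ hρ_sum hy hφ hC' a N).1, zero_div]
  have hZ2 : ∀ a, ∫ ω, Z a ω ^ 2 ∂pathLaw G = (1 - fullRatio ρ a) / fullRatio ρ a * τ := fun a => by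
    rw [hZ]
    simp only [div_pow, integral_div, (integral_totalDeviation hr hρ hρ_sum hy hφ hC' a N).2]
    have := (hpos a).ne'
    field_simp
    ring
  set g : (ℕ → Impression A) → ℝ := fun ω => (A : ℝ) / ((A : ℝ) + 1) * ∑ a, Z a ω ^ 2 with hg
  have hg0 : ∀ ω, 0 ≤ g ω := fun ω => by positivity
  have hgi : Integrable g (pathLaw G) := (integrable_finsetSum _ fun a _ => hZsq a).const_mul _
  have hgm : Measurable g :=
    (Finset.measurable_fun_sum _ fun a _ => (hZm a).pow_const 2).const_mul _
  -- The bound √x ≤ x + 1 reduces integrability of the root to that of `g`.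
  have hsi : Integrable (fun ω => Real.sqrt (g ω)) (pathLaw G) := by
    refine (hgi.add (integrable_const 1)).mono' (Real.continuous_sqrt.measurable.comp
      hgm).aestronglyMeasurable (.of_forall fun ω => ?_)
    rw [Real.norm_eq_abs, abs_of_nonneg (Real.sqrt_nonneg _)]
    change Real.sqrt (g ω) ≤ g ω + 1
    refine Real.sqrt_le_iff.2 ⟨by linarith [hg0 ω], ?_⟩
    have := hg0 ω
    nlinarith
  -- The variances produce E[τ] under the root; it is replaced by N here.
  have hτ_le : τ ≤ N := by
    have h1 : ∀ k, ∫ ω, alive G r v y φ N C k (past k ω) ∂pathLaw G ≤ 1 := fun k => by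
      have := integral_mono (integrable_alive (v := v) (y := y) (φ := φ) (N := N) (C := C) (G := G)
        hr k) (integrable_const 1) fun ω => (alive_mem k (past k ω)).2
      simpa using this
    have h2 := Finset.sum_le_sum fun k (_ : k ∈ Finset.range N) => h1 k
    simpa using h2
  have hEg : ∫ ω, g ω ∂pathLaw G =
      (A : ℝ) / ((A : ℝ) + 1) * (∑ a, (1 - fullRatio ρ a) / fullRatio ρ a) * τ := by
    rw [hg, integral_const_mul, integral_finsetSum _ fun a _ => hZsq a]
    simp only [hZ2]
    rw [← Finset.sum_mul, mul_assoc]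
  have hK : Real.sqrt (∫ ω, g ω ∂pathLaw G) ≤ Real.sqrt N * K ρ := by
    rw [hEg, K, ← Real.sqrt_mul (Nat.cast_nonneg N), mul_comm (N : ℝ)]
    refine Real.sqrt_le_sqrt (mul_le_mul_of_nonneg_left hτ_le (mul_nonneg (by positivity)
      (Finset.sum_nonneg fun a _ => ?_)))
    exact div_nonneg (by linarith [(fullRatio_mem hρ hρ_sum a).2]) (hpos a).le
  have hmain : ∫ ω, ((N : ℝ) - ∑ k ∈ Finset.range N, alive G r v y φ N C k (past k ω)) ∂pathLaw G ≤
      ∫ ω, ((∑ a, Z a ω) / ((A : ℝ) + 1) + Real.sqrt (g ω)) ∂pathLaw G := by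
    refine integral_mono ((integrable_const _).sub (integrable_finsetSum _ fun k _ =>
      integrable_alive hr k)) (((integrable_finsetSum _ fun a _ => hZi a).div_const _).add hsi)
      fun ω => ?_
    obtain ⟨a, ha⟩ := exists_sub_le_totalDeviation (G := G) (r := r) (v := v) (y := y) (φ := φ)
      hρ hρ_sum hC ω
    exact ha.trans (le_mean_add_sqrt (fun a => Z a ω) a)
  rw [integral_sub (integrable_const _) (integrable_finsetSum _ fun k _ => integrable_alive hr k),
    integral_finsetSum _ fun k _ => integrable_alive hr k, integral_add
      ((integrable_finsetSum _ fun a _ => hZi a).div_const _) hsi, integral_div,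
    integral_finsetSum _ fun a _ => hZi a] at hmain
  simp only [hZ0, Finset.sum_const_zero, zero_div, zero_add, integral_const, probReal_univ,
    one_smul] at hmain
  linarith [integral_sqrt_le hg0 hgi hsi]

theorem integral_alive_mul_stepYield (hr : IsRegular r)
    (hG : ∀ a, Integrable (fun q : Fin A → ℝ => q a) G) (hy : IsTieFlow G r ρ v y)
    (hφ : IsFallback φ) (hC : ∑ a, C a ≤ N) (n : ℕ) :
    Integrable (fun ω => alive G r v y φ N C n (past n ω) *
      (bidPricePolicy G r v y φ N C).stepYield r n (past n ω, ω n)) (pathLaw G) ∧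
    ∫ ω, alive G r v y φ N C n (past n ω) *
      (bidPricePolicy G r v y φ N C).stepYield r n (past n ω, ω n) ∂pathLaw G =
      (∫ ω, alive G r v y φ N C n (past n ω) ∂pathLaw G) * dual G r ρ v := by
  have hμ := isAdmissible_bidPricePolicy (C := C) hr hy hφ hC
  obtain ⟨M, hM⟩ := hr.bounded
  have hF : Measurable fun x => alive G r v y φ N C n x.1 *
      (bidPricePolicy G r v y φ N C).stepYield r n x :=
    ((measurable_alive hr n).comp measurable_fst).mul (hμ.measurable_stepYield hr n)
  have hFb : ∀ h z, |alive G r v y φ N C n h *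
      (bidPricePolicy G r v y φ N C).stepYield r n (h, z)| ≤ M + ∑ b, |z.1 b| := fun h z => by
    have h1 := alive_mem (G := G) (r := r) (v := v) (y := y) (φ := φ) (N := N) (C := C) n h
    rw [abs_mul, abs_of_nonneg h1.1]
    exact (mul_le_of_le_one_left (abs_nonneg _) h1.2).trans (hμ.abs_stepYield_le hr hM n h z)
  refine ⟨integrable_pathLaw hF (integrable_stepBound hG M) hFb,
    (integral_pathLaw hF (integrable_stepBound hG M) hFb).trans ?_⟩
  rw [← integral_mul_const]
  refine integral_congr_ae (.of_forall fun ω => ?_)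
  dsimp only
  rw [integral_const_mul]
  by_cases h : IsInterior (N - n) (remaining G r v y φ N C n (past n ω))
  · rw [integral_stepYield_of_isInterior hr hG hy hφ h]
  · simp [alive, h]

/-- The policy earns the dual value on every impression before the first exhaustion. -/
theorem sum_integral_alive_mul_dual_le_JB (hr : IsRegular r)
    (hG : ∀ a, Integrable (fun q : Fin A → ℝ => q a) G) (hG_nonneg : ∀ᵐ q ∂G, ∀ a, 0 ≤ q a)
    (hy : IsTieFlow G r ρ v y) (hφ : IsFallback φ) (hC : ∑ a, C a ≤ N) :
    (∑ k ∈ Finset.range N, ∫ ω, alive G r v y φ N C k (past k ω) ∂pathLaw G) * dual G r ρ v ≤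
      JB G r v y φ N C := by
  have hμ := isAdmissible_bidPricePolicy (C := C) hr hy hφ hC
  rw [JB, Policy.yield_eq, integral_finsetSum _ fun n _ => hμ.integrable_stepYield hr hG n,
    Finset.sum_mul]
  refine Finset.sum_le_sum fun n _ => ?_
  obtain ⟨h1, h2⟩ := integral_alive_mul_stepYield (φ := φ) hr hG hy hφ hC n
  rw [← h2]
  refine integral_mono_ae h1 (hμ.integrable_stepYield hr hG n) ?_
  filter_upwards [ae_pathLaw_quality_nonneg hG_nonneg] with ω hω
  -- The yields after exhaustion are dropped, which is allowed because they are almost surely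
  -- non-negative.
  refine mul_le_of_le_one_left ?_ (alive_mem n _).2
  have hs := hμ.accept_mem n (past n ω) (ω n).1
  have hq : ∀ c, 0 ≤ quality (ω n).1 c := fun c =>
    Fin.cases (motive := fun c => 0 ≤ quality (ω n).1 c) (by simp) (fun b => hω n b) c
  exact add_nonneg (hr.nonneg _ hs) (mul_nonneg (by linarith [hs.2]) (hq _))

theorem dual_nonneg (hr : IsRegular r) (hG : ∀ a, Integrable (fun q : Fin A → ℝ => q a) G)
    (hG_nonneg : ∀ᵐ q ∂G, ∀ a, 0 ≤ q a) (hy : IsTieFlow G r ρ v y) (hφ : IsFallback φ) :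
    0 ≤ dual G r ρ v := by
  rw [← integral_static_yield hr hG hy hφ]
  refine integral_nonneg_of_ae ?_
  filter_upwards [hG_nonneg] with q hq
  have hs := hr.sStar_mem (maxAdjusted v q)
  refine add_nonneg (hr.nonneg _ hs) (mul_nonneg (by linarith [hs.2])
    (Finset.sum_nonneg fun a _ => mul_nonneg (drawProb_nonneg hr hy hφ _ _ a) ?_))
  exact Fin.cases (motive := fun c => 0 ≤ quality q c) (by simp) hq a

/-- The first impression always earns the dual value. -/
theorem dual_le_JB (hr : IsRegular r) (hG : ∀ a, Integrable (fun q : Fin A → ℝ => q a) G)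
    (hG_nonneg : ∀ᵐ q ∂G, ∀ a, 0 ≤ q a) (hρ : ∀ a, 0 < ρ a) (hρ_sum : ∑ a, ρ a < 1)
    (hy : IsTieFlow G r ρ v y) (hφ : IsFallback φ) (hN : 0 < N)
    (hC : ∀ a, (C a : ℝ) = N * ρ a) : dual G r ρ v ≤ JB G r v y φ N C := by
  have hC' := sum_le_of_eq_mul hρ_sum hC
  have hN' : (0 : ℝ) < N := Nat.cast_pos.2 hN
  have hint : IsInterior N C := by
    constructor
    · intro a
      have : (0 : ℝ) < C a := by rw [hC]; exact mul_pos hN' (hρ a)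
      exact_mod_cast this
    · have : ((∑ a, C a : ℕ) : ℝ) < N := by
        push_cast
        simp only [hC, ← Finset.mul_sum]
        exact mul_lt_of_lt_one_right hN' hρ_sum
      exact_mod_cast this
  have h0 : ∫ ω, alive G r v y φ N C 0 (past 0 ω) ∂pathLaw G = 1 := by
    simp [alive, remaining, hint]
  have h1 := Finset.single_le_sum (f := fun k =>
    ∫ ω, alive G r v y φ N C k (past k ω) ∂pathLaw G)
    (fun k _ => integral_nonneg fun ω => (alive_mem k _).1) (Finset.mem_range.2 hN)
  rw [h0] at h1
  refine le_trans ?_ (sum_integral_alive_mul_dual_le_JB hr hG hG_nonneg hy hφ hC')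
  exact le_mul_of_one_le_left (dual_nonneg hr hG hG_nonneg hy hφ) h1

/-- Weak duality bounds all admissible yields, so the supremum is a genuine one; admissibility of
the bid-price policy makes the set non-empty. -/
theorem JB_le_JStar_le (hr : IsRegular r) (hG : ∀ a, Integrable (fun q : Fin A → ℝ => q a) G)
    (hρ_sum : ∑ a, ρ a < 1) (hy : IsTieFlow G r ρ v y) (hφ : IsFallback φ)
    (hC : ∀ a, (C a : ℝ) = N * ρ a) :
    JB G r v y φ N C ≤ JStar G r N C ∧ JStar G r N C ≤ JD G r ρ N := by
  have hμ := isAdmissible_bidPricePolicy (C := C) hr hy hφ (sum_le_of_eq_mul hρ_sum hC)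
  have hle : ∀ z ∈ {z | ∃ μ : Policy A, μ.IsAdmissible G N C ∧ z = μ.yield G r N},
      z ≤ JD G r ρ N := by
    rintro z ⟨μ, hμ, rfl⟩
    rw [JD_eq hr hG hy hφ]
    exact hμ.yield_le hr hG hC v
  exact ⟨le_csSup ⟨_, hle⟩ ⟨_, hμ, rfl⟩, csSup_le ⟨_, _, hμ, rfl⟩ hle⟩

theorem mul_JD_le_JB (hr : IsRegular r) (hG : ∀ a, Integrable (fun q : Fin A → ℝ => q a) G)
    (hG_nonneg : ∀ᵐ q ∂G, ∀ a, 0 ≤ q a) (hρ : ∀ a, 0 < ρ a) (hρ_sum : ∑ a, ρ a < 1)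
    (hy : IsTieFlow G r ρ v y) (hφ : IsFallback φ) (hN : 0 < N)
    (hC : ∀ a, (C a : ℝ) = N * ρ a) :
    (1 - 1 / Real.sqrt N * K ρ) * JD G r ρ N ≤ JB G r v y φ N C := by
  have hsq : 0 < Real.sqrt N := Real.sqrt_pos.2 (Nat.cast_pos.2 hN)
  have h1 : (1 - 1 / Real.sqrt N * K ρ) * JD G r ρ N =
      (N - Real.sqrt N * K ρ) * dual G r ρ v := by
    rw [JD_eq hr hG hy hφ]
    -- Writing the factors N as (√N)² lets the division by √N cancel.
    nth_rewrite 2 [← Real.sq_sqrt (Nat.cast_nonneg (α := ℝ) N)]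
    nth_rewrite 3 [← Real.sq_sqrt (Nat.cast_nonneg (α := ℝ) N)]
    field_simp
  rw [h1]
  exact (mul_le_mul_of_nonneg_right (sub_le_sum_integral_alive hr hρ hρ_sum hy hφ hC)
    (dual_nonneg hr hG hG_nonneg hy hφ)).trans
    (sum_integral_alive_mul_dual_le_JB hr hG hG_nonneg hy hφ (sum_le_of_eq_mul hρ_sum hC))

end Performance

end AdX

end

/-! ### Assembly of the theorem -/

theorem mainTheorem1 {A : ℕ} (G : Measure (Fin A → ℝ)) [IsProbabilityMeasure G]
    (hG_int : ∀ a, Integrable (fun q : Fin A → ℝ => q a) G)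
    (hG_nonneg : ∀ᵐ q ∂G, ∀ a, 0 ≤ q a)
    (r : ℝ → ℝ) (hr : AdX.IsRegular r)
    (ρ : Fin A → ℝ) (hρ : ∀ a, 0 < ρ a) (hρ_sum : ∑ a, ρ a < 1) :
    -- the bid prices and the tie-breaking rule that define the policy exist
    (∃ v, AdX.IsDualOptimal G r ρ v) ∧
    (AdX.UniqueMaximizers r →
      ∀ v, AdX.IsDualOptimal G r ρ v → ∃ y, AdX.IsTieFlow G r ρ v y) ∧
    -- performance of the policy
    ∀ v, AdX.IsDualOptimal G r ρ v → ∀ y, AdX.IsTieFlow G r ρ v y →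
    ∀ φ, AdX.IsFallback φ →
      (∀ (N : ℕ) (C : Fin A → ℕ), 0 < N → (∀ a, (C a : ℝ) = N * ρ a) →
        (AdX.bidPricePolicy G r v y φ N C).IsAdmissible G N C ∧
        AdX.JB G r v y φ N C ≤ AdX.JStar G r N C ∧
        AdX.JStar G r N C ≤ AdX.JD G r ρ N ∧
        (1 - 1 / Real.sqrt N * AdX.K ρ) * AdX.JD G r ρ N ≤ AdX.JB G r v y φ N C ∧
        AdX.JStar G r N C - AdX.JB G r v y φ N C ≤ Real.sqrt N * AdX.K ρ * AdX.JD G r ρ 1 ∧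
        (0 < AdX.JD G r ρ N →
          0 < AdX.JStar G r N C ∧
          AdX.JB G r v y φ N C / AdX.JStar G r N C ≥ AdX.JB G r v y φ N C / AdX.JD G r ρ N ∧
          AdX.JB G r v y φ N C / AdX.JD G r ρ N ≥ 1 - 1 / Real.sqrt N * AdX.K ρ)) ∧
      (∀ (N : ℕ → ℕ) (C : ℕ → Fin A → ℕ), Filter.Tendsto N Filter.atTop Filter.atTop →
        (∀ k a, (C k a : ℝ) = N k * ρ a) → 0 < AdX.JD G r ρ 1 →
        Filter.Tendsto
          (fun k => AdX.JB G r v y φ (N k) (C k) / AdX.JStar G r (N k) (C k))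
          Filter.atTop (nhds 1)) := by
  refine ⟨AdX.exists_isDualOptimal hr hG_int hG_nonneg hρ hρ_sum,
    fun hu v hv => hv.exists_isTieFlow hr hG_int hu, fun v _ y hy φ hφ => ?_⟩
  have hJD := AdX.JD_eq (N := 1) hr hG_int hy hφ
  rw [Nat.cast_one, one_mul] at hJD
  -- The bound 1 - K(ρ)/√N says nothing when K(ρ) ≥ √N, so positivity of J_N^B is taken from the
  -- first impression instead. It is needed before dividing by J_N^* and comparing quotients.
  have hpos : ∀ (N : ℕ) (C : Fin A → ℕ), 0 < N → (∀ a, (C a : ℝ) = N * ρ a) →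
      0 < AdX.dual G r ρ v → 0 < AdX.JB G r v y φ N C := fun N C hN hC hd =>
    hd.trans_le (AdX.dual_le_JB hr hG_int hG_nonneg hρ hρ_sum hy hφ hN hC)
  have hratio : ∀ (N : ℕ) (C : Fin A → ℕ), 0 < N → (∀ a, (C a : ℝ) = N * ρ a) →
      0 < AdX.JD G r ρ N → 0 < AdX.JStar G r N C ∧
      AdX.JB G r v y φ N C / AdX.JStar G r N C ≥ AdX.JB G r v y φ N C / AdX.JD G r ρ N ∧
      AdX.JB G r v y φ N C / AdX.JD G r ρ N ≥ 1 - 1 / Real.sqrt N * AdX.K ρ := by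
    intro N C hN hC hJ
    have hd : 0 < AdX.dual G r ρ v := by
      rw [AdX.JD_eq hr hG_int hy hφ] at hJ
      exact pos_of_mul_pos_right hJ (Nat.cast_nonneg N)
    have hB := hpos N C hN hC hd
    obtain ⟨h1, h2⟩ := AdX.JB_le_JStar_le hr hG_int hρ_sum hy hφ hC
    refine ⟨hB.trans_le h1, div_le_div_of_nonneg_left hB.le (hB.trans_le h1) h2, ?_⟩
    rw [ge_iff_le, le_div_iff₀ hJ]
    exact AdX.mul_JD_le_JB hr hG_int hG_nonneg hρ hρ_sum hy hφ hN hC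
  refine ⟨fun N C hN hC => ?_, fun N C hN hC hJ => ?_⟩
  · obtain ⟨h1, h2⟩ := AdX.JB_le_JStar_le hr hG_int hρ_sum hy hφ hC
    have h3 := AdX.mul_JD_le_JB hr hG_int hG_nonneg hρ hρ_sum hy hφ hN hC
    refine ⟨AdX.isAdmissible_bidPricePolicy hr hy hφ (AdX.sum_le_of_eq_mul hρ_sum hC), h1, h2, h3,
      ?_, hratio N C hN hC⟩
    have hsq : 0 < Real.sqrt N := Real.sqrt_pos.2 (Nat.cast_pos.2 hN)
    -- Linearity of J_N^D in N turns the relative loss of order 1/√N into an absolute loss of order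
    -- √N.
    have h4 : 1 / Real.sqrt N * AdX.K ρ * AdX.JD G r ρ N =
        Real.sqrt N * AdX.K ρ * AdX.JD G r ρ 1 := by
      rw [hJD, AdX.JD_eq hr hG_int hy hφ]
      nth_rewrite 2 [← Real.sq_sqrt (Nat.cast_nonneg (α := ℝ) N)]
      field_simp
    rw [sub_mul, one_mul, h4] at h3
    linarith
  · rw [hJD] at hJ
    have hlim : Filter.Tendsto (fun k => 1 - 1 / Real.sqrt (N k) * AdX.K ρ) Filter.atTop
        (nhds 1) := by
      have h1 : Filter.Tendsto (fun k => 1 / Real.sqrt (N k)) Filter.atTop (nhds 0) := by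
        simp only [one_div]
        exact (Real.tendsto_sqrt_atTop.comp (tendsto_natCast_atTop_atTop.comp hN)).inv_tendsto_atTop
      simpa using (h1.mul_const (AdX.K ρ)).const_sub 1
    -- Squeeze between 1 - K(ρ)/√N and 1; N may vanish at early indices, so both bounds are claimed
    -- only eventually.
    refine tendsto_of_tendsto_of_tendsto_of_le_of_le' hlim tendsto_const_nhds ?_ ?_
    · filter_upwards [hN.eventually_gt_atTop 0] with k hk
      have hJk : 0 < AdX.JD G r ρ (N k) := by
        rw [AdX.JD_eq hr hG_int hy hφ]
        exact mul_pos (Nat.cast_pos.2 hk) hJ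
      obtain ⟨-, h2, h3⟩ := hratio (N k) (C k) hk (hC k) hJk
      exact h3.trans h2
    · filter_upwards [hN.eventually_gt_atTop 0] with k hk
      have hB := hpos (N k) (C k) hk (hC k) hJ
      have h1 := (AdX.JB_le_JStar_le hr hG_int hρ_sum hy hφ (hC k)).1
      exact div_le_one_of_le₀ h1 (hB.trans_le h1).le
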